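/- For $p\ge 1$ and $a\in\mathbb R^{p\times p}$ write $\operatorname{mm}(a)=\min_{i\le p}\max_{j\le p}a_{i,j}$. Let $(p_n)$ be a sequence of positive integers with $\log p_n=o(n^{1/4})$. For every $n$ let $X^n=(X^n_1,\dots,X^n_n)$ be i.i.d. random variables with values in $\mathbb R^{p_n\times p_n}$, and suppose that $$\sup_n\Big\|\max_{i,j\le p_n}|X^n_{1,i,j}|\Big\|_{L_{12}}<\infty .$$ Put $\bar X^n=\frac1n\sum_{l\le n}X^n_l$. Let $Y^n=(Y^n_1,\dots,Y^n_n)$ be an independent copy of $X^n$, and let $Z^n=(Z^n_1,\dots,Z^n_n)$ be a bootstrap sample: conditionally on $X^n$ the $Z^n_l$ are i.i.d. and uniform on $\{X^n_1,\dots,X^n_n\}$ (counted with multiplicity). Define the recentered versions $$\tilde Y^n_l=Y^n_l+\bar X^n-\mathbb E[X^n_1],\qquad \tilde Z^n_l=Z^n_l-\bar X^n+\mathbb E[X^n_1].$$ Let $\hat\theta_n(x_{1:n})=\operatorname{mm}\big(\frac1n\sum_{l\le n}x_l\big)$, let $\theta_0=\operatorname{mm}(\mathbb E[X^n_1])$ (it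 may depend on $n$), and for $V\in\{Z^n,\tilde Z^n,\tilde Y^n\}$ let $\theta_V=\operatorname{mm}(\mathbb E[V_1\mid X^n])$. Let $\mathcal F$ be the class of all $h\in C^3(\mathbb R)$ with $\sup_x|h^{(k)}(x)|\le1$ for $k=1,2,3$, and for real random variables $U,V$ let $$d_{\mathcal F}(U,V\mid X^n)=\sup_{h\in\mathcal F}\mathbb E[h(U)-h(V)\mid X^n],$$ computed with the conditional laws of $U$ and $V$ given $X^n$. Then, as $n\to\infty$: 1. $\Big\|d_{\mathcal F}\big(\sqrt n(\hat\theta_n(Z^n)-\theta_{Z^n}),\ \sqrt n(\hat\theta_n(\tilde Y^n)-\theta_{\tilde Y^n})\mid X^n\big)\Big\|_{L_1}\to0$. 2. $\Big\|d_{\mathcal F}\big(\sqrt n(\hat\theta_n(\tilde Z^n)-\theta_{\tilde Z^n}),\ \sqrt n(\hat\theta_n(Y^n)-\theta_0)\mid X^n\big)\Big\|_{L_1}\to0$. 3. Assume in addition that $p_n\ge2$ for all sufficiently large $n$. Let $\alpha\in[0,1]$ and let $t_{n,\alpha}=t_{n,\alpha}(X^n)$ be thresholds such that, for every $n$, almost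 surely $$\mathbb P\big(\sqrt n(\hat\theta_n(\tilde Z^n)-\theta_{\tilde Z^n})\ge t_{n,\alpha}\mid X^n\big)\le\alpha .$$ Then for every sequence $\varepsilon_n>0$ with $\varepsilon_n\to0$ and $\big(\log(p_n)^2/\sqrt n\big)^{1/9}=o(\varepsilon_n)$, $$\limsup_{n\to\infty}\mathbb P\big(\sqrt n(\hat\theta_n(X^n)-\theta_0)\ge t_{n,\alpha}+\varepsilon_n\big)\le\alpha .$$ -/

import Mathlib

open MeasureTheory ProbabilityTheory Filter Topology Asymptotics
open scoped ENNReal NNReal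

namespace MinMaxBootstrap

noncomputable section

/-- A single observation: a `p × p` array of reals, with the product sigma-algebra. -/
abbrev Obs (p : ℕ) : Type := Fin p → Fin p → ℝ

/-- `min_i max_j a_{i,j}` (an honest minimum and maximum as soon as `p ≥ 1`). -/
def minMax {p : ℕ} (a : Obs p) : ℝ := ⨅ i, ⨆ j, a i j

/-- `max_{i,j} |a_{i,j}|`. -/
def maxAbs {p : ℕ} (a : Obs p) : ℝ := ⨆ i, ⨆ j, |a i j|

/-- The entrywise sample mean of the sample `x_1, …, x_n`. -/
def sampleMean {n p : ℕ} (x : Fin n → Obs p) : Obs p :=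
  fun i j => (1 / (n : ℝ)) * ∑ l, x l i j

/-- The estimator `min_i max_j (1/n) ∑_l x_{l,i,j}`. -/
def thetaHat {n p : ℕ} (x : Fin n → Obs p) : ℝ := minMax (sampleMean x)

/-- The entrywise mean of one observation with law `m`. -/
def meanOf {p : ℕ} (m : Measure (Obs p)) : Obs p := fun i j => ∫ y, y i j ∂m

/-- The min-max value `min_i max_j E[V_{i,j}]` for an observation `V` with (conditional) law `m`. -/
def theta {p : ℕ} (m : Measure (Obs p)) : ℝ := minMax (meanOf m)

/-- Conditional law, given the data `x`, of one bootstrap draw `Z_1`: uniform on `x_1, …, x_n`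
(with multiplicity). -/
def bootLaw {n p : ℕ} (x : Fin n → Obs p) : Measure (Obs p) :=
  (n : ℝ≥0∞)⁻¹ • ∑ l, Measure.dirac (x l)

/-- Conditional law, given the data `x`, of one centered bootstrap draw
`Z_1 - (sample mean - E[X_1])`, where `X_1` has law `ν`. -/
def centeredBootLaw {n p : ℕ} (ν : Measure (Obs p)) (x : Fin n → Obs p) : Measure (Obs p) :=
  (bootLaw x).map (fun z => z - (sampleMean x - meanOf ν))

/-- Conditional law, given the data `x`, of the recentered fresh observation
`Y_1 + sample mean - E[X_1]`, where `Y_1` has law `ν` and is independent of the data. -/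
def recenteredLaw {n p : ℕ} (ν : Measure (Obs p)) (x : Fin n → Obs p) : Measure (Obs p) :=
  ν.map (fun y => y + sampleMean x - meanOf ν)

/-- The law of `√n (θ̂_n(V_1, …, V_n) - θ_V)` when `V_1, …, V_n` are i.i.d. with law `m` and
`θ_V = min_i max_j E[V_{1,i,j}]`. -/
def rootLaw (n : ℕ) {p : ℕ} (m : Measure (Obs p)) : Measure ℝ :=
  (Measure.pi (fun _ : Fin n => m)).map
    (fun v : Fin n → Obs p => √(n : ℝ) * (thetaHat v - theta m))

/-- Three times continuously differentiable functions whose first three derivatives are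
bounded by one. -/
def testClass : Set (ℝ → ℝ) :=
  {h | ContDiff ℝ 3 h ∧ ∀ k : ℕ, 1 ≤ k → k ≤ 3 → ∀ x, |iteratedDeriv k h x| ≤ 1}

/-- The metric `sup_h E_{U ∼ μ, V ∼ μ'} [h(U) - h(V)]` over the test class; the supremum is
nonnegative, as the class contains the zero function. -/
def dF (μ μ' : Measure ℝ) : ℝ≥0∞ :=
  ⨆ h ∈ testClass, ENNReal.ofReal ((∫ s, h s ∂μ) - ∫ s, h s ∂μ')

end

end MinMaxBootstrap

namespace MinMaxBootstrap

noncomputable section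

/-! The proof is Lindeberg's replacement method for a smoothed min-max, followed by bounds for the
expectation of the resulting data-dependent error. Replacing maxima and minima by log-sum-exp at
inverse temperature `b` costs at most `log p / b`. The derivatives of the smoothed functional are
polynomials in Gibbs averages, so with respect to the sup norm they are of order `1`, `b`, `b ^ 2`,
with no dependence on the dimension. If two laws have equal means, exchanging one summand of scale
`1 / √n` has no first order effect, a second order effect `b / n` times the largest difference of
second moments, and a remainder `b ^ 2 / n ^ (3 / 2)` times third moments. Adding up `n` exchanges
gives `dF_rootLaw_le`.

Recentring is what makes the means agree, and both comparisons then obey the same bound `errBound`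
for every fixed sample. That bound contains the sup-norm errors of the empirical first and second
moments, over at most `p ^ 4` coordinates; `integral_norm_mean_le` controls their expectations with
only a logarithm of the dimension. For `b ^ 3 = (1 + log p) * √n` all terms are of order `b ^ 2 /
√n`, whose cube is `(1 + log p) ^ 2 / √n`; it tends to zero because `log p = o(n ^ (1 / 4))`.

For the test, a smooth step of width `δ` is a test function after multiplication by a constant times
`δ ^ 3`. By Markov's inequality the conditional distance is below a small multiple of `δ ^ 3`
outside an event of probability of order `rate / δ ^ 3`, which is why the shift must dominate the
cube root of the rate. The threshold depends on the same data as the statistic. This is harmless: on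
the good event the threshold plus `δ` lies in a deterministic set of levels, those with small tail
under the true law (`measure_shifted_threshold_le`). -/

/-- The average of `u` under the Gibbs weights `exp (g i) / ∑ exp g`. -/
def gibbs {ι : Type*} [Fintype ι] (g u : ι → ℝ) : ℝ :=
  (∑ i, Real.exp (g i) * u i) / ∑ i, Real.exp (g i)

/-- The log-sum-exp function, a smooth maximum, at inverse temperature `b`. -/
def lse {ι : Type*} [Fintype ι] (b : ℝ) (s : ι → ℝ) : ℝ :=
  (1 / b) * Real.log (∑ i, Real.exp (b * s i))

/-- A smooth version of `minMax`. -/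
def softMinMax {p : ℕ} (b : ℝ) (a : Obs p) : ℝ := -lse b (fun i => -lse b (a i))

/-! ### Gibbs averages and log-sum-exp. -/

section Gibbs

variable {ι : Type*} [Fintype ι]

lemma sum_exp_pos [Nonempty ι] (g : ι → ℝ) : 0 < ∑ i, Real.exp (g i) :=
  Finset.sum_pos (fun _ _ => Real.exp_pos _) Finset.univ_nonempty

lemma gibbs_sub (g u v : ι → ℝ) : gibbs g (fun i => u i - v i) = gibbs g u - gibbs g v := by
  simp only [gibbs, mul_sub, Finset.sum_sub_distrib, sub_div]

lemma gibbs_const_mul (g u : ι → ℝ) (c : ℝ) : gibbs g (fun i => c * u i) = c * gibbs g u := by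
  simp only [gibbs, mul_left_comm _ c, ← Finset.mul_sum, mul_div_assoc]

lemma gibbs_mul_const (g u : ι → ℝ) (c : ℝ) : gibbs g (fun i => u i * c) = gibbs g u * c := by
  simp only [mul_comm _ c, gibbs_const_mul]

lemma gibbs_zero (g : ι → ℝ) : gibbs g (fun _ => 0) = 0 := by simp [gibbs]

lemma abs_gibbs_le [Nonempty ι] (g : ι → ℝ) {u : ι → ℝ} {R : ℝ} (h : ∀ i, |u i| ≤ R) :
    |gibbs g u| ≤ R := by
  have hpos := sum_exp_pos g
  rw [gibbs, abs_div, abs_of_pos hpos, div_le_iff₀ hpos, Finset.mul_sum]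
  refine (Finset.abs_sum_le_sum_abs _ _).trans (Finset.sum_le_sum fun i _ => ?_)
  rw [abs_mul, abs_of_pos (Real.exp_pos _), mul_comm]
  exact mul_le_mul_of_nonneg_right (h i) (Real.exp_pos _).le

lemma integrable_gibbs {E : Type*} [MeasurableSpace E] {m : Measure E} (g : ι → ℝ)
    {u : E → ι → ℝ} (hu : ∀ i, Integrable (fun y => u y i) m) :
    Integrable (fun y => gibbs g (u y)) m :=
  (integrable_finsetSum _ fun i _ => (hu i).const_mul _).div_const _

lemma integral_gibbs {E : Type*} [MeasurableSpace E] {m : Measure E} (g : ι → ℝ)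
    {u : E → ι → ℝ} (hu : ∀ i, Integrable (fun y => u y i) m) :
    ∫ y, gibbs g (u y) ∂m = gibbs g (fun i => ∫ y, u y i ∂m) := by
  simp only [gibbs]
  rw [integral_div, integral_finsetSum _ fun i _ => (hu i).const_mul _]
  simp only [integral_const_mul]

/-- Differentiating the weights produces the Gibbs covariance of `g'` and `u`. All higher
derivatives below come from iterating this rule. -/
lemma hasDerivAt_gibbs [Nonempty ι] {g u : ℝ → ι → ℝ} {g' u' : ι → ℝ} {t : ℝ}
    (hg : ∀ i, HasDerivAt (fun t => g t i) (g' i) t)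
    (hu : ∀ i, HasDerivAt (fun t => u t i) (u' i) t) :
    HasDerivAt (fun t => gibbs (g t) (u t))
      (gibbs (g t) u' + gibbs (g t) (fun i => g' i * u t i)
        - gibbs (g t) g' * gibbs (g t) (u t)) t := by
  have hpos := sum_exp_pos (g t)
  have h1 : HasDerivAt (fun t => ∑ i, Real.exp (g t i) * u t i)
      (∑ i, (Real.exp (g t i) * g' i * u t i + Real.exp (g t i) * u' i)) t :=
    HasDerivAt.fun_sum fun i _ => (hg i).exp.mul (hu i)
  have h2 : HasDerivAt (fun t => ∑ i, Real.exp (g t i)) (∑ i, Real.exp (g t i) * g' i) t :=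
    HasDerivAt.fun_sum fun i _ => (hg i).exp
  refine (h1.div h2 hpos.ne').congr_deriv ?_
  simp only [gibbs, Finset.sum_add_distrib, ← mul_assoc]
  field_simp
  ring

lemma hasDerivAt_lse [Nonempty ι] {b : ℝ} (hb : 0 < b) {s : ℝ → ι → ℝ} {s' : ι → ℝ} {t : ℝ}
    (hs : ∀ i, HasDerivAt (fun t => s t i) (s' i) t) :
    HasDerivAt (fun t => lse b (s t)) (gibbs (fun i => b * s t i) s') t := by
  have h2 : HasDerivAt (fun t => ∑ i, Real.exp (b * s t i))
      (∑ i, Real.exp (b * s t i) * (b * s' i)) t :=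
    HasDerivAt.fun_sum fun i _ => ((hs i).const_mul b).exp
  refine ((h2.log (sum_exp_pos _).ne').const_mul (1 / b)).congr_deriv ?_
  simp only [gibbs, mul_left_comm _ b, ← Finset.mul_sum]
  field_simp

lemma le_lse {b : ℝ} (hb : 0 < b) (s : ι → ℝ) (i : ι) : s i ≤ lse b s := by
  have : Nonempty ι := ⟨i⟩
  rw [lse, one_div, ← div_eq_inv_mul, le_div_iff₀ hb, mul_comm,
    Real.le_log_iff_exp_le (sum_exp_pos _)]
  exact Finset.single_le_sum (f := fun i => Real.exp (b * s i))
    (fun _ _ => (Real.exp_pos _).le) (Finset.mem_univ i)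

lemma lse_le [Nonempty ι] {b : ℝ} (hb : 0 < b) {s : ι → ℝ} {R : ℝ} (h : ∀ i, s i ≤ R) :
    lse b s ≤ R + Real.log (Fintype.card ι) / b := by
  have hc : (0 : ℝ) < Fintype.card ι := by exact_mod_cast Fintype.card_pos
  have h1 : ∑ i, Real.exp (b * s i) ≤ Fintype.card ι * Real.exp (b * R) := by
    refine (Finset.sum_le_card_nsmul _ _ (Real.exp (b * R)) fun i _ => ?_).trans_eq ?_
    · exact Real.exp_le_exp.2 (mul_le_mul_of_nonneg_left (h i) hb.le)
    · simp [Finset.card_univ]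
  have h2 := Real.log_le_log (sum_exp_pos _) h1
  rw [Real.log_mul hc.ne' (Real.exp_pos _).ne', Real.log_exp] at h2
  rw [lse, one_div, ← div_eq_inv_mul, div_le_iff₀ hb, add_mul, div_mul_cancel₀ _ hb.ne']
  linarith

lemma continuous_lse [Nonempty ι] (b : ℝ) : Continuous (lse b : (ι → ℝ) → ℝ) := by
  unfold lse
  refine continuous_const.mul (Continuous.log (by fun_prop) fun s => (sum_exp_pos _).ne')

end Gibbs

lemma continuous_softMinMax {p : ℕ} [NeZero p] (b : ℝ) :
    Continuous (softMinMax b : Obs p → ℝ) :=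
  ((continuous_lse b).comp (continuous_pi fun i =>
    ((continuous_lse b).comp (continuous_apply i)).neg)).neg

/-- The soft maxima overshoot and the soft minimum undershoot, each by at most `log p / b`. The two
errors have opposite signs, so no factor two appears. -/
lemma abs_softMinMax_sub_minMax_le {p : ℕ} [NeZero p] {b : ℝ} (hb : 0 < b) (a : Obs p) :
    |softMinMax b a - minMax a| ≤ Real.log p / b := by
  have hrow (i : Fin p) : (⨆ j, a i j) ≤ lse b (a i) := ciSup_le fun j => le_lse hb _ j
  have hrow' (i : Fin p) : lse b (a i) ≤ (⨆ j, a i j) + Real.log p / b := by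
    simpa using lse_le hb (s := a i) (R := ⨆ j, a i j)
      fun j => le_ciSup (Set.finite_range _).bddAbove j
  have hmin (i : Fin p) : minMax a ≤ ⨆ j, a i j := ciInf_le (Set.finite_range _).bddBelow i
  rw [abs_le]
  constructor
  · have := lse_le hb (s := fun i => -lse b (a i)) (R := -minMax a) fun i => by
      linarith [hrow i, hmin i]
    simp only [Fintype.card_fin] at this
    unfold softMinMax
    linarith
  · suffices softMinMax b a - Real.log p / b ≤ minMax a by linarith
    refine le_ciInf fun i => ?_
    have := le_lse hb (fun i => -lse b (a i)) i
    have := hrow' i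
    unfold softMinMax
    linarith

lemma abs_mul_le_of_le {u v U V : ℝ} (hu : |u| ≤ U) (hv : |v| ≤ V) : |u * v| ≤ U * V := by
  rw [abs_mul]
  exact mul_le_mul hu hv (abs_nonneg _) ((abs_nonneg _).trans hu)

lemma abs_sub_le_of_le {u v U V : ℝ} (hu : |u| ≤ U) (hv : |v| ≤ V) : |u - v| ≤ U + V :=
  (abs_sub _ _).trans (add_le_add hu hv)

lemma abs_add_le_of_le {u v U V : ℝ} (hu : |u| ≤ U) (hv : |v| ≤ V) : |u + v| ≤ U + V :=
  (abs_add_le _ _).trans (add_le_add hu hv)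

lemma abs_const_mul_le_of_le {c u U : ℝ} (hc : 0 ≤ c) (hu : |u| ≤ U) : |c * u| ≤ c * U := by
  rw [abs_mul, abs_of_nonneg hc]
  exact mul_le_mul_of_nonneg_left hu hc

/-! ### Derivatives of the soft min-max along a line. -/

section Line

variable {p : ℕ}

/-- The logarithms of the Gibbs weights of the rows in the soft minimum. -/
def rowWeight (b : ℝ) (a : Obs p) (i : Fin p) : ℝ := b * -lse b (a i)

/-- The soft maximum average of `u` in row `i`. -/
def colAvg (b : ℝ) (a : Obs p) (u : Obs p) (i : Fin p) : ℝ := gibbs (fun j => b * a i j) (u i)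

/-- The average of `u` under the weights given by the gradient of `softMinMax b` at `a`. -/
def rowAvg (b : ℝ) (a : Obs p) (u : Fin p → ℝ) : ℝ := gibbs (rowWeight b a) u

/-- The first derivative of `softMinMax b` at `a` in direction `x`. -/
def softGrad (b : ℝ) (a x : Obs p) : ℝ := rowAvg b a (colAvg b a x)

/-- The second derivative of `softMinMax b` at `a` in direction `x`. -/
def softHess (b : ℝ) (a x : Obs p) : ℝ :=
  b * (rowAvg b a (colAvg b a (fun i j => x i j * x i j))
    - 2 * rowAvg b a (fun i => colAvg b a x i * colAvg b a x i)
    + softGrad b a x * softGrad b a x)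

/-- The derivative of the row averages of the squares along the line through `a` in direction
`x`. -/
def colSqDeriv (b : ℝ) (a x : Obs p) (i : Fin p) : ℝ :=
  b * (colAvg b a (fun i j => x i j * (x i j * x i j)) i
    - colAvg b a x i * colAvg b a (fun i j => x i j * x i j) i)

/-- The derivative of the row averages along the line through `a` in direction `x`. -/
def colDeriv (b : ℝ) (a x : Obs p) (i : Fin p) : ℝ :=
  b * (colAvg b a (fun i j => x i j * x i j) i - colAvg b a x i * colAvg b a x i)

/-- The derivative of a row average of `u`, where `u` has derivative `u'`. -/
def rowDeriv (b : ℝ) (a x : Obs p) (u u' : Fin p → ℝ) : ℝ :=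
  rowAvg b a u' - b * (rowAvg b a (fun i => colAvg b a x i * u i)
    - softGrad b a x * rowAvg b a u)

/-- The third derivative of `softMinMax b` at `a` in direction `x`. -/
def softThird (b : ℝ) (a x : Obs p) : ℝ :=
  b * (rowDeriv b a x (colAvg b a (fun i j => x i j * x i j)) (colSqDeriv b a x)
    - 2 * rowDeriv b a x (fun i => colAvg b a x i * colAvg b a x i)
        (fun i => 2 * (colAvg b a x i * colDeriv b a x i))
    + 2 * (softGrad b a x * softHess b a x))

lemma hasDerivAt_line (a x : Obs p) (t : ℝ) (i j : Fin p) :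
    HasDerivAt (fun t : ℝ => (a + t • x) i j) (x i j) t := by
  have := ((hasDerivAt_id t).mul_const (x i j)).const_add (a i j)
  simpa using this

variable [NeZero p] {b : ℝ} (a x : Obs p)

lemma hasDerivAt_colAvg_line (u : Obs p) (t : ℝ) (i : Fin p) :
    HasDerivAt (fun t : ℝ => colAvg b (a + t • x) u i)
      (b * (colAvg b (a + t • x) (fun i j => x i j * u i j) i
        - colAvg b (a + t • x) x i * colAvg b (a + t • x) u i)) t := by
  have := hasDerivAt_gibbs (g := fun t j => b * (a + t • x) i j) (u := fun _ => u i)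
    (g' := fun j => b * x i j) (u' := fun _ => 0) (t := t)
    (fun j => (hasDerivAt_line a x t i j).const_mul b) (fun j => hasDerivAt_const _ _)
  refine this.congr_deriv ?_
  simp only [gibbs_zero, mul_assoc, gibbs_const_mul, colAvg]
  ring

lemma hasDerivAt_rowAvg_line (hb : 0 < b) {u : ℝ → Fin p → ℝ} {u' : Fin p → ℝ} {t : ℝ}
    (hu : ∀ i, HasDerivAt (fun t => u t i) (u' i) t) :
    HasDerivAt (fun t : ℝ => rowAvg b (a + t • x) (u t))
      (rowDeriv b (a + t • x) x (u t) u') t := by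
  have hw (i : Fin p) : HasDerivAt (fun t : ℝ => rowWeight b (a + t • x) i)
      (b * -colAvg b (a + t • x) x i) t :=
    ((hasDerivAt_lse hb fun j => hasDerivAt_line a x t i j).neg).const_mul b
  refine (hasDerivAt_gibbs hw hu).congr_deriv ?_
  simp only [gibbs_const_mul, rowDeriv, rowAvg, softGrad, mul_assoc, neg_mul]
  have e1 (v : Fin p → ℝ) : gibbs (rowWeight b (a + t • x)) (fun i => -v i)
      = -gibbs (rowWeight b (a + t • x)) v := by
    simpa using gibbs_const_mul (rowWeight b (a + t • x)) v (-1)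
  rw [e1, e1]
  ring

lemma hasDerivAt_softMinMax_line (hb : 0 < b) (t : ℝ) :
    HasDerivAt (fun t : ℝ => softMinMax b (a + t • x)) (softGrad b (a + t • x) x) t := by
  have h := (hasDerivAt_lse hb (s := fun t i => -lse b ((a + t • x) i)) (t := t)
    fun i => (hasDerivAt_lse hb fun j => hasDerivAt_line a x t i j).neg).neg
  refine h.congr_deriv ?_
  rw [softGrad, rowAvg, ← neg_one_mul, ← gibbs_const_mul]
  simp only [neg_mul, one_mul, neg_neg]
  rfl

/-- The soft maxima contribute `b` times the averaged variance within rows, the soft minimum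
contributes `-b` times the variance of the row averages. The averaged squares of the row averages
occur in both, whence the coefficient `-2` in `softHess`. -/
lemma hasDerivAt_softGrad_line (hb : 0 < b) (t : ℝ) :
    HasDerivAt (fun t : ℝ => softGrad b (a + t • x) x) (softHess b (a + t • x) x) t := by
  refine (hasDerivAt_rowAvg_line a x hb
    (fun i => hasDerivAt_colAvg_line a x x t i)).congr_deriv ?_
  simp only [rowDeriv, softHess, softGrad, rowAvg, gibbs_const_mul, gibbs_sub]
  ring

lemma hasDerivAt_softHess_line (hb : 0 < b) (t : ℝ) :
    HasDerivAt (fun t : ℝ => softHess b (a + t • x) x) (softThird b (a + t • x) x) t := by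
  have h1 := hasDerivAt_rowAvg_line a x hb
    (fun i => hasDerivAt_colAvg_line (b := b) a x (fun i j => x i j * x i j) t i)
  have h2 := hasDerivAt_rowAvg_line a x hb (fun i =>
    (hasDerivAt_colAvg_line (b := b) a x x t i).mul (hasDerivAt_colAvg_line (b := b) a x x t i))
  have h3 := (hasDerivAt_softGrad_line a x hb t).mul (hasDerivAt_softGrad_line a x hb t)
  refine (((h1.sub (h2.const_mul 2)).add h3).const_mul b).congr_deriv ?_
  have e : (fun i => 2 * (colAvg b (a + t • x) x i * colDeriv b (a + t • x) x i))
    = fun i => b * (colAvg b (a + t • x) (fun i j => x i j * x i j) i -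
                    colAvg b (a + t • x) x i * colAvg b (a + t • x) x i) *
                colAvg b (a + t • x) x i +
              colAvg b (a + t • x) x i *
                (b * (colAvg b (a + t • x) (fun i j => x i j * x i j) i -
                  colAvg b (a + t • x) x i * colAvg b (a + t • x) x i)) := by
    funext i; simp only [colDeriv]; ring
  rw [softThird, e]
  simp only [Pi.mul_apply]
  unfold colSqDeriv
  ring

variable {a x} {R : ℝ}

lemma abs_colAvg_le {u : Obs p} (hx : ∀ i j, |u i j| ≤ R) (i : Fin p) : |colAvg b a u i| ≤ R :=
  abs_gibbs_le _ (hx i)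

lemma abs_rowAvg_le {u : Fin p → ℝ} (hu : ∀ i, |u i| ≤ R) : |rowAvg b a u| ≤ R :=
  abs_gibbs_le _ hu

lemma abs_softGrad_le (hx : ∀ i j, |x i j| ≤ R) : |softGrad b a x| ≤ R :=
  abs_rowAvg_le (abs_colAvg_le hx)

lemma abs_softHess_le (hb : 0 < b) (hx : ∀ i j, |x i j| ≤ R) :
    |softHess b a x| ≤ 4 * b * (R * R) := by
  have h := abs_const_mul_le_of_le hb.le (abs_add_le_of_le (abs_sub_le_of_le
    (abs_rowAvg_le (b := b) (a := a) (abs_colAvg_le (b := b) (a := a)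
      (fun i j => abs_mul_le_of_le (hx i j) (hx i j))))
    (abs_const_mul_le_of_le zero_le_two (abs_rowAvg_le (b := b) (a := a) (fun i =>
      abs_mul_le_of_le (abs_colAvg_le (b := b) (a := a) hx i)
        (abs_colAvg_le (b := b) (a := a) hx i)))))
    (abs_mul_le_of_le (abs_softGrad_le (b := b) (a := a) hx)
      (abs_softGrad_le (b := b) (a := a) hx)))
  refine h.trans_eq (by ring)

lemma abs_rowDeriv_le (hb : 0 < b) (hx : ∀ i j, |x i j| ≤ R) {u u' : Fin p → ℝ} {U U' : ℝ}
    (hu : ∀ i, |u i| ≤ U) (hu' : ∀ i, |u' i| ≤ U') :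
    |rowDeriv b a x u u'| ≤ U' + b * (R * U + R * U) :=
  abs_sub_le_of_le (abs_rowAvg_le hu') (abs_const_mul_le_of_le hb.le (abs_sub_le_of_le
    (abs_rowAvg_le fun i => abs_mul_le_of_le (abs_colAvg_le hx i) (hu i))
    (abs_mul_le_of_le (abs_softGrad_le hx) (abs_rowAvg_le hu))))

/-- A Gibbs average never exceeds the sup norm, so only the number of terms matters: `4 + 2 * 6 + 2
* 4 = 24`, counting the squared row averages and the gradient-Hessian product twice. -/
lemma abs_softThird_le (hb : 0 < b) (hx : ∀ i j, |x i j| ≤ R) :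
    |softThird b a x| ≤ 24 * b ^ 2 * R ^ 3 := by
  have hsq := fun i j => abs_mul_le_of_le (hx i j) (hx i j)
  have hcub := fun i j => abs_mul_le_of_le (hx i j) (hsq i j)
  have hc := abs_colAvg_le (b := b) (a := a) hx
  have hc2 := abs_colAvg_le (b := b) (a := a) hsq
  have hc3 := abs_colAvg_le (b := b) (a := a) hcub
  have h1 := abs_rowDeriv_le (a := a) hb hx hc2 (u' := colSqDeriv b a x) (fun i =>
    abs_const_mul_le_of_le hb.le (abs_sub_le_of_le (hc3 i) (abs_mul_le_of_le (hc i) (hc2 i))))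
  have h2 := abs_rowDeriv_le (a := a) hb hx (fun i => abs_mul_le_of_le (hc i) (hc i))
    (u' := fun i => 2 * (colAvg b a x i * colDeriv b a x i)) (fun i =>
      abs_const_mul_le_of_le zero_le_two (abs_mul_le_of_le (hc i)
        (abs_const_mul_le_of_le hb.le (abs_sub_le_of_le (hc2 i) (abs_mul_le_of_le (hc i) (hc i))))))
  have h3 := abs_mul_le_of_le (abs_softGrad_le (b := b) (a := a) hx)
    (abs_softHess_le (a := a) hb hx)
  refine (abs_const_mul_le_of_le hb.le (abs_add_le_of_le (abs_sub_le_of_le h1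
    (abs_const_mul_le_of_le zero_le_two h2)) (abs_const_mul_le_of_le zero_le_two h3))).trans_eq ?_
  ring

end Line

/-- The mean value inequality is applied three times, to the successive Taylor remainders on `[0,
1]`. Not integrating the powers of `t` costs the factor `1 / 6`, which is irrelevant here. -/
lemma abs_sub_taylor_two_le {g g1 g2 g3 : ℝ → ℝ} {M : ℝ}
    (h0 : ∀ t, HasDerivAt g (g1 t) t) (h1 : ∀ t, HasDerivAt g1 (g2 t) t)
    (h2 : ∀ t, HasDerivAt g2 (g3 t) t) (hM : ∀ t, |g3 t| ≤ M) :
    |g 1 - (g 0 + g1 0 + g2 0 / 2)| ≤ M := by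
  have hM0 : 0 ≤ M := (abs_nonneg _).trans (hM 0)
  have key {f f' : ℝ → ℝ} (hf : ∀ t, HasDerivAt f (f' t) t) (hf0 : f 0 = 0)
      (hb : ∀ t ∈ Set.Icc (0 : ℝ) 1, |f' t| ≤ M) (t : ℝ) (ht : t ∈ Set.Icc (0 : ℝ) 1) :
      |f t| ≤ M := by
    have := norm_image_sub_le_of_norm_deriv_le_segment' (f := f) (f' := f') (a := 0) (b := t)
      (C := M) (fun s _ => (hf s).hasDerivWithinAt)
      (fun s hs => hb s ⟨hs.1, hs.2.le.trans ht.2⟩) t ⟨ht.1, le_rfl⟩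
    rw [hf0, sub_zero, sub_zero, Real.norm_eq_abs] at this
    exact this.trans (mul_le_of_le_one_right hM0 ht.2)
  have k2 := key (f := fun t => g2 t - g2 0) (f' := g3) (fun t => (h2 t).sub_const _)
    (sub_self _) (fun t _ => hM t)
  have k1 := key (f := fun t => g1 t - (g1 0 + t * g2 0)) (f' := fun t => g2 t - g2 0)
    (fun t => (h1 t).sub (by
      simpa using ((hasDerivAt_id t).mul_const (g2 0)).const_add (g1 0))) (by simp) k2
  have k0 := key (f := fun t => g t - (g 0 + t * g1 0 + t * t * (g2 0 / 2)))
    (f' := fun t => g1 t - (g1 0 + t * g2 0))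
    (fun t => (h0 t).sub (by
      have := (((hasDerivAt_id t).mul_const (g1 0)).const_add (g 0)).add
        (((hasDerivAt_id t).mul (hasDerivAt_id t)).mul_const (g2 0 / 2))
      refine this.congr_deriv ?_
      simp only [id]; ring)) (by simp) k1 1 (by simp)
  simpa using k0

lemma hasDerivAt_iteratedDeriv_of_mem_testClass {h : ℝ → ℝ} (hh : h ∈ testClass) {k : ℕ}
    (hk : k < 3) (t : ℝ) : HasDerivAt (iteratedDeriv k h) (iteratedDeriv (k + 1) h t) t := by
  rw [iteratedDeriv_succ]
  exact ((hh.1.differentiable_iteratedDeriv k (by exact_mod_cast hk)) t).hasDerivAt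

/-! ### Expansion of a test function of the soft min-max. -/

section TestFunction

variable {p : ℕ} [NeZero p] {b : ℝ} {h : ℝ → ℝ} {a x : Obs p} {R : ℝ}

/-- The second derivative at `a` in direction `x` of `h (softMinMax b · - c)`. -/
def testHess (h : ℝ → ℝ) (b c : ℝ) (a x : Obs p) : ℝ :=
  iteratedDeriv 2 h (softMinMax b a - c) * (softGrad b a x * softGrad b a x)
    + iteratedDeriv 1 h (softMinMax b a - c) * softHess b a x

lemma hasDerivAt_test_line (hb : 0 < b) (hh : h ∈ testClass) (c t : ℝ) {k : ℕ} (hk : k < 3) :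
    HasDerivAt (fun t : ℝ => iteratedDeriv k h (softMinMax b (a + t • x) - c))
      (iteratedDeriv (k + 1) h (softMinMax b (a + t • x) - c) * softGrad b (a + t • x) x) t :=
  HasDerivAt.comp (h := fun t : ℝ => softMinMax b (a + t • x) - c) t
    (hasDerivAt_iteratedDeriv_of_mem_testClass hh hk _)
    ((hasDerivAt_softMinMax_line a x hb t).sub_const c)

lemma abs_test_taylor_le (hb : 1 ≤ b) (hh : h ∈ testClass) (c : ℝ) (hx : ∀ i j, |x i j| ≤ R) :
    |h (softMinMax b (a + x) - c) - (h (softMinMax b a - c)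
      + iteratedDeriv 1 h (softMinMax b a - c) * softGrad b a x + testHess h b c a x / 2)|
      ≤ 37 * b ^ 2 * R ^ 3 := by
  have hb0 : 0 < b := one_pos.trans_le hb
  have hR : 0 ≤ R := (abs_nonneg _).trans (hx 0 0)
  have hd := hh.2
  have d0 (t : ℝ) := hasDerivAt_test_line (a := a) (x := x) hb0 hh c t (k := 0) (by norm_num)
  have d1 (t : ℝ) := hasDerivAt_test_line (a := a) (x := x) hb0 hh c t (k := 1) (by norm_num)
  have d2 (t : ℝ) := hasDerivAt_test_line (a := a) (x := x) hb0 hh c t (k := 2) (by norm_num)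
  have e1 (t : ℝ) := (d1 t).mul (hasDerivAt_softGrad_line a x hb0 t)
  have e2 (t : ℝ) := ((d2 t).mul ((hasDerivAt_softGrad_line a x hb0 t).mul
    (hasDerivAt_softGrad_line a x hb0 t))).add ((d1 t).mul (hasDerivAt_softHess_line a x hb0 t))
  have key := abs_sub_taylor_two_le (M := 37 * b ^ 2 * R ^ 3) d0 e1
    (fun t => (e2 t).congr_of_eventuallyEq (Eventually.of_forall fun s => by
      simp only [Pi.mul_apply, Pi.add_apply]; ring)) (fun t => ?_)
  · simpa [testHess, mul_assoc] using key
  · simp only [Pi.mul_apply]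
    set A := a + t • x
    have g1 := abs_softGrad_le (b := b) (a := A) hx
    have g2 := abs_softHess_le (a := A) hb0 hx
    have g3 := abs_softThird_le (a := A) hb0 hx
    have k1 := hd 1 le_rfl (by norm_num) (softMinMax b A - c)
    have k2 := hd 2 (by norm_num) (by norm_num) (softMinMax b A - c)
    have k3 := hd 3 (by norm_num) (by norm_num) (softMinMax b A - c)
    have := abs_add_le_of_le (abs_add_le_of_le
        (abs_mul_le_of_le (abs_mul_le_of_le k3 g1) (abs_mul_le_of_le g1 g1))
        (abs_mul_le_of_le k2 (abs_add_le_of_le (abs_mul_le_of_le g2 g1) (abs_mul_le_of_le g1 g2))))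
        (abs_add_le_of_le (abs_mul_le_of_le (abs_mul_le_of_le k2 g1) g2) (abs_mul_le_of_le k1 g3))
    refine this.trans ?_
    -- The third derivative is at most `(1 + 12 * b + 24 * b ^ 2) * R ^ 3`; since `b ≥ 1` this is at
    -- most `37 * b ^ 2 * R ^ 3`.
    have hbb : b ≤ b ^ 2 := by nlinarith
    have hb1 : 1 ≤ b ^ 2 := by nlinarith
    have hR3 : 0 ≤ R ^ 3 := by positivity
    nlinarith [mul_le_mul_of_nonneg_right hbb hR3, mul_le_mul_of_nonneg_right hb1 hR3]

/-- The gradient is an average and `|h'| ≤ 1`, so the composition is 1-Lipschitz for the sup norm.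
This supplies integrability, as `h` itself may be unbounded. -/
lemma abs_test_sub_le (hb : 0 < b) (hh : h ∈ testClass) (c : ℝ) (hx : ∀ i j, |x i j| ≤ R) :
    |h (softMinMax b (a + x) - c) - h (softMinMax b a - c)| ≤ R := by
  have := norm_image_sub_le_of_norm_deriv_le_segment_01'
    (f := fun t : ℝ => h (softMinMax b (a + t • x) - c)) (C := R)
    (fun t _ => (hasDerivAt_test_line (a := a) (x := x) hb hh c t (k := 0)
      (by norm_num)).hasDerivWithinAt) (fun t _ => by
        have := abs_mul_le_of_le (hh.2 1 le_rfl (by norm_num) (softMinMax b (a + t • x) - c))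
          (abs_softGrad_le (b := b) (a := a + t • x) hx)
        simpa using this)
  simpa using this

end TestFunction

/-! ### The second order term as a linear form in second moments. -/

section OneStep

variable {p : ℕ} {b : ℝ} {a : Obs p}

/-- The bilinear form associated with `testHess`, evaluated at the array `K` of coefficients. -/
def testHessForm (h : ℝ → ℝ) (b c : ℝ) (a : Obs p) (K : Fin p → Fin p → Fin p → Fin p → ℝ) : ℝ :=
  iteratedDeriv 2 h (softMinMax b a - c) *
      rowAvg b a (colAvg b a fun i j => rowAvg b a (colAvg b a (K i j)))
    + iteratedDeriv 1 h (softMinMax b a - c) * (b *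
      (rowAvg b a (colAvg b a fun i j => K i j i j)
      - 2 * rowAvg b a (colAvg b a fun i j => colAvg b a (K i j) i)
      + rowAvg b a (colAvg b a fun i j => rowAvg b a (colAvg b a (K i j)))))

lemma colAvg_const_mul (b : ℝ) (a u : Obs p) (c : ℝ) :
    colAvg b a (fun i j => c * u i j) = fun i => c * colAvg b a u i :=
  funext fun _ => gibbs_const_mul _ _ _

lemma colAvg_mul_const (b : ℝ) (a u : Obs p) (c : ℝ) :
    colAvg b a (fun i j => u i j * c) = fun i => colAvg b a u i * c :=
  funext fun _ => gibbs_mul_const _ _ _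

lemma colAvg_mul_row (b : ℝ) (a u : Obs p) (c : Fin p → ℝ) :
    colAvg b a (fun i j => u i j * c i) = fun i => colAvg b a u i * c i :=
  funext fun _ => gibbs_mul_const _ _ _

lemma rowAvg_const_mul (b : ℝ) (a : Obs p) (u : Fin p → ℝ) (c : ℝ) :
    rowAvg b a (fun i => c * u i) = c * rowAvg b a u := gibbs_const_mul _ _ _

lemma rowAvg_mul_const (b : ℝ) (a : Obs p) (u : Fin p → ℝ) (c : ℝ) :
    rowAvg b a (fun i => u i * c) = rowAvg b a u * c := gibbs_mul_const _ _ _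

lemma softGrad_smul (a x : Obs p) (r : ℝ) : softGrad b a (r • x) = r * softGrad b a x := by
  rw [softGrad, softGrad, ← rowAvg_const_mul, ← colAvg_const_mul]
  rfl

/-- The quadratic form in `x` is linear in the array of products `x i j * x k l`. Integration
therefore acts on that array alone, and two laws can be compared through the entrywise difference of
their second moments. -/
lemma testHess_eq_testHessForm (h : ℝ → ℝ) (c : ℝ) (a x : Obs p) :
    testHess h b c a x = testHessForm h b c a (fun i j k l => x i j * x k l) := by
  rw [testHess, softHess, testHessForm]
  simp only [softGrad, colAvg_const_mul, rowAvg_const_mul, colAvg_mul_const, rowAvg_mul_const,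
    colAvg_mul_row]

lemma testHess_smul (h : ℝ → ℝ) (c r : ℝ) (a x : Obs p) :
    testHess h b c a (r • x) = r ^ 2 * testHess h b c a x := by
  have e0 : colAvg b a (r • x) = fun i => r * colAvg b a x i := colAvg_const_mul b a x r
  have e2 : colAvg b a (fun i j => (r • x) i j * (r • x) i j)
      = fun i => r ^ 2 * colAvg b a (fun i j => x i j * x i j) i := by
    rw [← colAvg_const_mul]
    congr 1
    funext i j
    simp only [Pi.smul_apply, smul_eq_mul]
    ring
  have e3 : (fun i => colAvg b a (r • x) i * colAvg b a (r • x) i)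
      = fun i => r ^ 2 * (colAvg b a x i * colAvg b a x i) := by
    funext i
    rw [e0]
    ring
  rw [testHess, testHess, softHess, softHess, softGrad_smul, e2, e3, rowAvg_const_mul,
    rowAvg_const_mul]
  ring

lemma testHessForm_sub (h : ℝ → ℝ) (c : ℝ) (a : Obs p)
    (K K' : Fin p → Fin p → Fin p → Fin p → ℝ) :
    testHessForm h b c a (fun i j k l => K i j k l - K' i j k l)
      = testHessForm h b c a K - testHessForm h b c a K' := by
  have ec (u v : Obs p) : colAvg b a (fun i j => u i j - v i j)
      = fun i => colAvg b a u i - colAvg b a v i := by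
    funext i
    exact gibbs_sub _ _ _
  have er (u v : Fin p → ℝ) : rowAvg b a (fun i => u i - v i) = rowAvg b a u - rowAvg b a v :=
    gibbs_sub _ _ _
  simp only [testHessForm, ec, er]
  ring

lemma abs_testHessForm_le [NeZero p] (hb : 0 < b) {h : ℝ → ℝ} (hh : h ∈ testClass) (c : ℝ)
    {K : Fin p → Fin p → Fin p → Fin p → ℝ} {D : ℝ} (hK : ∀ i j k l, |K i j k l| ≤ D) :
    |testHessForm h b c a K| ≤ (1 + 4 * b) * D := by
  have h1 : |rowAvg b a (colAvg b a fun i j => rowAvg b a (colAvg b a (K i j)))| ≤ D :=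
    abs_rowAvg_le <| abs_colAvg_le fun i j => abs_rowAvg_le <| abs_colAvg_le (hK i j)
  have h2 : |rowAvg b a (colAvg b a fun i j => K i j i j)| ≤ D :=
    abs_rowAvg_le <| abs_colAvg_le fun i j => hK i j i j
  have h3 : |rowAvg b a (colAvg b a fun i j => colAvg b a (K i j) i)| ≤ D :=
    abs_rowAvg_le <| abs_colAvg_le fun i j => abs_colAvg_le (hK i j) i
  refine (abs_add_le_of_le
    (abs_mul_le_of_le (hh.2 2 (by norm_num) (by norm_num) _) h1)
    (abs_mul_le_of_le (hh.2 1 le_rfl (by norm_num) _)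
      (abs_const_mul_le_of_le hb.le (abs_add_le_of_le (abs_sub_le_of_le h2
        (abs_const_mul_le_of_le zero_le_two h3)) h1)))).trans_eq ?_
  ring

lemma integrable_rowAvg {m : Measure (Obs p)} {u : Obs p → Fin p → ℝ}
    (hu : ∀ i, Integrable (fun y => u y i) m) : Integrable (fun y => rowAvg b a (u y)) m :=
  integrable_gibbs _ hu

lemma integrable_colAvg {m : Measure (Obs p)} {u : Obs p → Obs p}
    (hu : ∀ i j, Integrable (fun y => u y i j) m) (i : Fin p) :
    Integrable (fun y => colAvg b a (u y) i) m :=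
  integrable_gibbs _ (hu i)

lemma integral_rowAvg_colAvg {m : Measure (Obs p)} {u : Obs p → Obs p}
    (hu : ∀ i j, Integrable (fun y => u y i j) m) :
    ∫ y, rowAvg b a (colAvg b a (u y)) ∂m
      = rowAvg b a (colAvg b a fun i j => ∫ y, u y i j ∂m) :=
  (integral_gibbs _ fun i => integrable_colAvg hu i).trans
    (congrArg _ (funext fun i => integral_gibbs _ (hu i)))

lemma integrable_softGrad {m : Measure (Obs p)}
    (h1 : ∀ i j, Integrable (fun y : Obs p => y i j) m) :
    Integrable (fun y => softGrad b a y) m :=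
  integrable_rowAvg (integrable_colAvg h1)

lemma integral_softGrad {m : Measure (Obs p)}
    (h1 : ∀ i j, Integrable (fun y : Obs p => y i j) m) :
    ∫ y, softGrad b a y ∂m = softGrad b a (meanOf m) :=
  integral_rowAvg_colAvg h1

lemma integrable_testHessForm_and_integral {m : Measure (Obs p)} (h : ℝ → ℝ) (c : ℝ)
    {K : Obs p → Fin p → Fin p → Fin p → Fin p → ℝ}
    (h2 : ∀ i j k l, Integrable (fun y : Obs p => K y i j k l) m) :
    Integrable (fun y => testHessForm h b c a (K y)) m ∧
    ∫ y, testHessForm h b c a (K y) ∂m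
      = testHessForm h b c a (fun i j k l => ∫ y, K y i j k l ∂m) := by
  have i0 (i j k : Fin p) : Integrable (fun y => colAvg b a (K y i j) k) m :=
    integrable_colAvg (h2 i j) k
  have i00 (i j : Fin p) : Integrable (fun y => rowAvg b a (colAvg b a (K y i j))) m :=
    integrable_rowAvg (i0 i j)
  have i1 : Integrable (fun y =>
      rowAvg b a (colAvg b a fun i j => rowAvg b a (colAvg b a (K y i j)))) m :=
    integrable_rowAvg (integrable_colAvg i00)
  have i2 : Integrable (fun y => rowAvg b a (colAvg b a fun i j => K y i j i j)) m :=
    integrable_rowAvg (integrable_colAvg fun i j => h2 i j i j)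
  have i3 : Integrable (fun y => rowAvg b a (colAvg b a fun i j => colAvg b a (K y i j) i)) m :=
    integrable_rowAvg (integrable_colAvg fun i j => i0 i j i)
  have e1 : ∫ y, rowAvg b a (colAvg b a fun i j => rowAvg b a (colAvg b a (K y i j))) ∂m
      = rowAvg b a (colAvg b a fun i j => rowAvg b a (colAvg b a
          fun k l => ∫ y, K y i j k l ∂m)) := by
    rw [integral_rowAvg_colAvg i00]
    congr 2
    funext i j
    exact integral_rowAvg_colAvg (h2 i j)
  have e2 : ∫ y, rowAvg b a (colAvg b a fun i j => K y i j i j) ∂m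
      = rowAvg b a (colAvg b a fun i j => ∫ y, K y i j i j ∂m) :=
    integral_rowAvg_colAvg fun i j => h2 i j i j
  have e3 : ∫ y, rowAvg b a (colAvg b a fun i j => colAvg b a (K y i j) i) ∂m
      = rowAvg b a (colAvg b a fun i j => colAvg b a (fun k l => ∫ y, K y i j k l ∂m) i) := by
    rw [integral_rowAvg_colAvg fun i j => i0 i j i]
    congr 2
    funext i j
    exact integral_gibbs _ (h2 i j i)
  have i4 : Integrable (fun y => rowAvg b a (colAvg b a fun i j => K y i j i j)
      - 2 * rowAvg b a (colAvg b a fun i j => colAvg b a (K y i j) i)) m := i2.sub (i3.const_mul 2)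
  have i5 : Integrable (fun y => rowAvg b a (colAvg b a fun i j => K y i j i j)
      - 2 * rowAvg b a (colAvg b a fun i j => colAvg b a (K y i j) i)
      + rowAvg b a (colAvg b a fun i j => rowAvg b a (colAvg b a (K y i j)))) m := i4.add i1
  refine ⟨(i1.const_mul _).add ((i5.const_mul b).const_mul _), ?_⟩
  simp only [testHessForm]
  rw [integral_add (i1.const_mul _) ((i5.const_mul b).const_mul _),
    integral_const_mul, integral_const_mul, integral_const_mul,
    integral_add i4 i1, integral_sub i2 (i3.const_mul 2),
    integral_const_mul, e1, e2, e3]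

end OneStep

/-! ### Integrability, product measures and the unsmoothed statistic. -/

lemma abs_apply_le_norm {p : ℕ} (x : Obs p) (i j : Fin p) : |x i j| ≤ ‖x‖ :=
  (norm_le_pi_norm (x i) j).trans (norm_le_pi_norm x i)

lemma pow_le_one_add_pow {r : ℝ} (hr : 0 ≤ r) {j k : ℕ} (hjk : j ≤ k) : r ^ j ≤ 1 + r ^ k := by
  rcases le_total r 1 with h | h
  · linarith [pow_le_one₀ (n := j) hr h, pow_nonneg hr k]
  · linarith [pow_le_pow_right₀ h hjk]

lemma integrable_norm_pow_of_le {p : ℕ} {m : Measure (Obs p)} [IsFiniteMeasure m] {j k : ℕ}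
    (hjk : j ≤ k) (hm : Integrable (fun y => ‖y‖ ^ k) m) : Integrable (fun y => ‖y‖ ^ j) m := by
  refine ((integrable_const 1).add hm).mono'
    (by fun_prop) (Eventually.of_forall fun y => ?_)
  rw [Real.norm_of_nonneg (by positivity)]
  exact pow_le_one_add_pow (norm_nonneg y) hjk

lemma integrable_entry {p : ℕ} {m : Measure (Obs p)}
    (hm : Integrable (fun y => ‖y‖) m) (i j : Fin p) : Integrable (fun y : Obs p => y i j) m :=
  hm.mono' (Measurable.aestronglyMeasurable (by fun_prop))
    (Eventually.of_forall fun y => abs_apply_le_norm y i j)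

lemma integrable_entry_mul {p : ℕ} {m : Measure (Obs p)}
    (hm : Integrable (fun y => ‖y‖ ^ 2) m) (i j k l : Fin p) :
    Integrable (fun y : Obs p => y i j * y k l) m :=
  hm.mono' (Measurable.aestronglyMeasurable (by fun_prop)) (Eventually.of_forall fun y =>
    (abs_mul_le_of_le (abs_apply_le_norm y i j) (abs_apply_le_norm y k l)).trans_eq (sq _).symm)

lemma integral_pi_succ {E : Type*} [MeasurableSpace E] (m : Measure E) [SigmaFinite m] {n : ℕ}
    (F : (Fin (n + 1) → E) → ℝ) :
    ∫ y, F y ∂(Measure.pi fun _ => m)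
      = ∫ z : E × (Fin n → E), F (Fin.cons z.1 z.2) ∂(m.prod (Measure.pi fun _ => m)) := by
  have := (measurePreserving_piFinSuccAbove (fun _ : Fin (n + 1) => m) 0).symm
  rw [← this.integral_comp' (g := F)]
  simp [MeasurableEquiv.piFinSuccAbove_symm_apply, Fin.insertNthEquiv]

lemma integrable_of_abs_sub_le {V : Type*} [NormedAddCommGroup V] {f : V → ℝ} (hf : Continuous f)
    (hlip : ∀ s x, |f (s + x) - f s| ≤ ‖x‖) {E : Type*} [MeasurableSpace E] {μ : Measure E}
    [IsFiniteMeasure μ] {u : E → V} (hu : Integrable u μ) (s : V) :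
    Integrable (fun z => f (s + u z)) μ := by
  refine ((integrable_const |f s|).add hu.norm).mono'
    ((hf.comp (continuous_const.add continuous_id)).comp_aestronglyMeasurable hu.1)
    (Eventually.of_forall fun y => ?_)
  have := hlip s (u y)
  have h2 := abs_sub_abs_le_abs_sub (f (s + u y)) (f s)
  simp only [Real.norm_eq_abs, Pi.add_apply]
  linarith

section MinMax

variable {p : ℕ}

lemma measurable_minMax : Measurable (minMax : Obs p → ℝ) := by
  unfold minMax
  exact Measurable.iInf fun i => Measurable.iSup fun j => by fun_prop

lemma measurable_sampleMean {n : ℕ} : Measurable (sampleMean : (Fin n → Obs p) → Obs p) := by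
  unfold sampleMean
  fun_prop

lemma measurable_thetaHat {n : ℕ} : Measurable (thetaHat : (Fin n → Obs p) → ℝ) :=
  measurable_minMax.comp measurable_sampleMean

lemma measurable_root {n : ℕ} (c : ℝ) :
    Measurable (fun v : Fin n → Obs p => √(n : ℝ) * (thetaHat v - c)) :=
  (measurable_thetaHat.sub_const c).const_mul _

lemma minMax_smul {c : ℝ} (hc : 0 ≤ c) (a : Obs p) : minMax (c • a) = c * minMax a := by
  simp only [minMax, Pi.smul_apply, smul_eq_mul]
  rw [Real.mul_iInf_of_nonneg hc]
  simp only [Real.mul_iSup_of_nonneg hc]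

lemma sqrt_smul_sampleMean {n : ℕ} (hn : n ≠ 0) (v : Fin n → Obs p) :
    √(n : ℝ) • sampleMean v = ∑ l, (√(n : ℝ))⁻¹ • v l := by
  have h0 : (0 : ℝ) < n := by positivity
  funext i j
  simp only [sampleMean, Pi.smul_apply, smul_eq_mul, Finset.sum_apply, ← Finset.mul_sum]
  rw [← mul_assoc]
  congr 1
  rw [one_div, eq_comm, inv_eq_iff_eq_inv, mul_inv, inv_inv, ← div_eq_inv_mul,
    Real.div_sqrt]

end MinMax

lemma abs_sub_le_of_mem_testClass {h : ℝ → ℝ} (hh : h ∈ testClass) (u v : ℝ) :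
    |h u - h v| ≤ |u - v| := by
  have := Convex.norm_image_sub_le_of_norm_hasDerivWithin_le (f := h)
    (f' := iteratedDeriv 1 h) (C := 1) (s := Set.univ) (x := v) (y := u)
    (fun t _ => by
      have := hasDerivAt_iteratedDeriv_of_mem_testClass hh (k := 0) (by norm_num) t
      rw [iteratedDeriv_zero] at this
      exact this.hasDerivWithinAt)
    (fun t _ => hh.2 1 le_rfl (by norm_num) t) convex_univ trivial trivial
  simpa using this

lemma theta_eq_of_meanOf_eq {p : ℕ} {m₁ m₂ : Measure (Obs p)} (h : meanOf m₁ = meanOf m₂) :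
    theta m₁ = theta m₂ := by rw [theta, theta, h]

/-- Lindeberg replacement by induction, through the hybrid law with head `m₁` and tail `m₂`. With
the head fixed, the tail is exchanged by the induction hypothesis at a shifted base point; with the
tail frozen, the head is exchanged by `hstep`. Both need uniformity in the base point `s`. -/
lemma abs_integral_sum_sub_le {p : ℕ} {m₁ m₂ : Measure (Obs p)} [IsProbabilityMeasure m₁]
    [IsProbabilityMeasure m₂] {f : Obs p → ℝ} (hf : Continuous f)
    (hlip : ∀ s x, |f (s + x) - f s| ≤ ‖x‖) {r e : ℝ}
    (hm₁ : Integrable (fun y => y) m₁) (hm₂ : Integrable (fun y => y) m₂)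
    (hstep : ∀ s, |∫ y, f (s + r • y) ∂m₁ - ∫ y, f (s + r • y) ∂m₂| ≤ e) (n : ℕ) (s : Obs p) :
    |∫ y : Fin n → Obs p, f (s + ∑ l, r • y l) ∂(Measure.pi fun _ => m₁)
      - ∫ y : Fin n → Obs p, f (s + ∑ l, r • y l) ∂(Measure.pi fun _ => m₂)| ≤ n * e := by
  induction n generalizing s with
  | zero => simp
  | succ n ih =>
    have isum {m : Measure (Obs p)} [IsProbabilityMeasure m] (hm : Integrable (fun y => y) m) :
        Integrable (fun y : Fin n → Obs p => ∑ l, r • y l) (Measure.pi fun _ => m) :=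
      integrable_finsetSum _ fun l _ =>
        (integrable_comp_eval (μ := fun _ : Fin n => m) (i := l) hm).smul r
    have hprod {m m' : Measure (Obs p)} [IsProbabilityMeasure m] [IsProbabilityMeasure m']
        (hm : Integrable (fun y => y) m) (hm' : Integrable (fun y => y) m') :
        Integrable (fun z : Obs p × (Fin n → Obs p) => f (s + (r • z.1 + ∑ l, r • z.2 l)))
          (m.prod (Measure.pi fun _ => m')) :=
      integrable_of_abs_sub_le hf hlip
        (((hm.smul r).comp_fst _).add ((isum hm').comp_snd m)) s
    have hsucc (m : Measure (Obs p)) [IsProbabilityMeasure m] :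
        ∫ y : Fin (n + 1) → Obs p, f (s + ∑ l, r • y l) ∂(Measure.pi fun _ => m)
          = ∫ z : Obs p × (Fin n → Obs p), f (s + (r • z.1 + ∑ l, r • z.2 l))
            ∂(m.prod (Measure.pi fun _ => m)) := by
      rw [integral_pi_succ]
      simp [Fin.sum_univ_succ]
    rw [hsucc, hsucc]
    have hA : |∫ z : Obs p × (Fin n → Obs p), f (s + (r • z.1 + ∑ l, r • z.2 l))
            ∂(m₁.prod (Measure.pi fun _ => m₁))
        - ∫ z : Obs p × (Fin n → Obs p), f (s + (r • z.1 + ∑ l, r • z.2 l))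
            ∂(m₁.prod (Measure.pi fun _ => m₂))| ≤ n * e := by
      rw [integral_prod _ (hprod hm₁ hm₁), integral_prod _ (hprod hm₁ hm₂),
        ← integral_sub (hprod hm₁ hm₁).integral_prod_left (hprod hm₁ hm₂).integral_prod_left]
      rw [← Real.norm_eq_abs]
      refine (norm_integral_le_of_norm_le_const (C := n * e)
        (Eventually.of_forall fun y => ?_)).trans_eq (by simp)
      simpa only [add_assoc, Real.norm_eq_abs] using ih (s + r • y)
    have hB : |∫ z : Obs p × (Fin n → Obs p), f (s + (r • z.1 + ∑ l, r • z.2 l))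
            ∂(m₁.prod (Measure.pi fun _ => m₂))
        - ∫ z : Obs p × (Fin n → Obs p), f (s + (r • z.1 + ∑ l, r • z.2 l))
            ∂(m₂.prod (Measure.pi fun _ => m₂))| ≤ e := by
      rw [integral_prod_symm _ (hprod hm₁ hm₂), integral_prod_symm _ (hprod hm₂ hm₂),
        ← integral_sub (hprod hm₁ hm₂).integral_prod_right (hprod hm₂ hm₂).integral_prod_right]
      rw [← Real.norm_eq_abs]
      refine (norm_integral_le_of_norm_le_const (C := e)
        (Eventually.of_forall fun y => ?_)).trans_eq (by simp)
      have := hstep (s + ∑ l, r • y l)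
      simpa only [add_assoc, add_comm (∑ l, r • y l), Real.norm_eq_abs] using this
    refine (abs_sub_le _ _ _).trans ((add_le_add hA hB).trans_eq ?_)
    push_cast
    ring

/-! ### Distance between two laws with equal means. -/

section Compare

variable {p : ℕ} [NeZero p] {b : ℝ} {m m₁ m₂ : Measure (Obs p)}
  [IsProbabilityMeasure m] [IsProbabilityMeasure m₁] [IsProbabilityMeasure m₂]

lemma continuous_test {h : ℝ → ℝ} (hh : h ∈ testClass) (b c : ℝ) :
    Continuous (fun a : Obs p => h (softMinMax b a - c)) :=
  hh.1.continuous.comp ((continuous_softMinMax b).sub continuous_const)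

/-- Up to a third moment, the expectation after adding one summand depends on `m` only through its
means and second moments. -/
lemma abs_integral_test_sub_taylor_le (hb : 1 ≤ b) {h : ℝ → ℝ} (hh : h ∈ testClass)
    (c : ℝ) (s : Obs p) {r : ℝ} (hr : 0 ≤ r) (hm : Integrable (fun y => ‖y‖ ^ 3) m) :
    |∫ y, h (softMinMax b (s + r • y) - c) ∂m - (h (softMinMax b s - c)
      + iteratedDeriv 1 h (softMinMax b s - c) * (r * softGrad b s (meanOf m))
      + r ^ 2 * testHessForm h b c s (fun i j k l => ∫ y, y i j * y k l ∂m) / 2)|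
      ≤ 37 * b ^ 2 * r ^ 3 * ∫ y, ‖y‖ ^ 3 ∂m := by
  have hm1 : Integrable (fun y => ‖y‖) m := by
    simpa using integrable_norm_pow_of_le (j := 1) (by norm_num) hm
  have he := fun i j => integrable_entry hm1 i j
  have hee := fun i j k l => integrable_entry_mul
    (integrable_norm_pow_of_le (j := 2) (by norm_num) hm) i j k l
  have hn (y : Obs p) : ∀ i j, |(r • y) i j| ≤ r * ‖y‖ := fun i j => by
    simpa [abs_of_nonneg hr] using mul_le_mul_of_nonneg_left (abs_apply_le_norm y i j) hr
  have hi : Integrable (fun y => h (softMinMax b (s + r • y) - c)) m := by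
    refine ((integrable_const (|h (softMinMax b s - c)|)).add (hm1.const_mul r)).mono'
      (((continuous_test hh b c).comp (by fun_prop)).aestronglyMeasurable)
      (Eventually.of_forall fun y => ?_)
    have := abs_test_sub_le (a := s) (one_pos.trans_le hb) hh c (hn y)
    have h2 := abs_sub_abs_le_abs_sub (h (softMinMax b (s + r • y) - c)) (h (softMinMax b s - c))
    simp only [Real.norm_eq_abs, Pi.add_apply]
    linarith
  have hT1 := ((integrable_softGrad (b := b) (a := s) he).const_mul r).const_mul
    (iteratedDeriv 1 h (softMinMax b s - c))
  have hT2 := ((integrable_testHessForm_and_integral (b := b) (a := s) h c hee).1.const_mul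
    (r ^ 2)).div_const 2
  have hT0 : Integrable (fun y => h (softMinMax b s - c)
      + iteratedDeriv 1 h (softMinMax b s - c) * (r * softGrad b s y)) m :=
    (integrable_const _).add hT1
  have hT : Integrable (fun y => h (softMinMax b s - c)
      + iteratedDeriv 1 h (softMinMax b s - c) * (r * softGrad b s y)
      + r ^ 2 * testHessForm h b c s (fun i j k l => y i j * y k l) / 2) m := hT0.add hT2
  have eT : h (softMinMax b s - c)
      + iteratedDeriv 1 h (softMinMax b s - c) * (r * softGrad b s (meanOf m))
      + r ^ 2 * testHessForm h b c s (fun i j k l => ∫ y, y i j * y k l ∂m) / 2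
      = ∫ y, (h (softMinMax b s - c)
      + iteratedDeriv 1 h (softMinMax b s - c) * (r * softGrad b s y)
      + r ^ 2 * testHessForm h b c s (fun i j k l => y i j * y k l) / 2) ∂m := by
    rw [integral_add hT0 hT2, integral_add (integrable_const _) hT1,
      integral_div, integral_const_mul, integral_const_mul, integral_const_mul,
      integral_softGrad he, (integrable_testHessForm_and_integral h c hee).2]
    simp
  rw [eT, ← integral_sub hi hT, ← integral_const_mul]
  rw [← Real.norm_eq_abs]
  refine norm_integral_le_of_norm_le (hm.const_mul _) (Eventually.of_forall fun y => ?_)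
  have := abs_test_taylor_le (a := s) hb hh c (hn y)
  rw [softGrad_smul, testHess_smul, testHess_eq_testHessForm] at this
  rw [Real.norm_eq_abs]
  refine this.trans_eq ?_
  ring

lemma abs_integral_test_sub_le (hb : 1 ≤ b) {h : ℝ → ℝ} (hh : h ∈ testClass)
    (c : ℝ) (s : Obs p) {r : ℝ} (hr : 0 ≤ r) {D : ℝ}
    (hm₁ : Integrable (fun y => ‖y‖ ^ 3) m₁) (hm₂ : Integrable (fun y => ‖y‖ ^ 3) m₂)
    (hmean : meanOf m₁ = meanOf m₂)
    (hD : ∀ i j k l, |∫ y, y i j * y k l ∂m₁ - ∫ y, y i j * y k l ∂m₂| ≤ D) :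
    |∫ y, h (softMinMax b (s + r • y) - c) ∂m₁ - ∫ y, h (softMinMax b (s + r • y) - c) ∂m₂|
      ≤ r ^ 2 * (3 * b * D)
        + 37 * b ^ 2 * r ^ 3 * (∫ y, ‖y‖ ^ 3 ∂m₁ + ∫ y, ‖y‖ ^ 3 ∂m₂) := by
  have h1 := abs_integral_test_sub_taylor_le hb hh c s hr hm₁
  have h2 := abs_integral_test_sub_taylor_le hb hh c s hr hm₂
  have h3 := abs_testHessForm_le (a := s) (one_pos.trans_le hb) hh c hD
  have hD0 : 0 ≤ D := (abs_nonneg _).trans (hD 0 0 0 0)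
  rw [testHessForm_sub h c s (fun i j k l => ∫ y, y i j * y k l ∂m₁)] at h3
  rw [hmean] at h1
  have h4 := abs_const_mul_le_of_le (c := r ^ 2 / 2) (by positivity) h3
  -- Half of `1 + 4 * b` is at most `3 * b` because `b ≥ 1`.
  have h5 : r ^ 2 / 2 * ((1 + 4 * b) * D) ≤ r ^ 2 * (3 * b * D) := by
    have : 0 ≤ r ^ 2 * D := by positivity
    nlinarith
  rw [abs_le] at h1 h2 h4 ⊢
  constructor <;> nlinarith

/-- Positive homogeneity of `minMax` moves `√n` inside, so the smoothing acts at the scale of the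
normalized sum. As `h` is 1-Lipschitz, smoothing costs no more than its uniform error. -/
lemma abs_integral_rootLaw_sub_le {n : ℕ} (hn : n ≠ 0) (hb : 0 < b) {h : ℝ → ℝ}
    (hh : h ∈ testClass) (hm : Integrable (fun y => y) m) :
    |∫ t, h t ∂(rootLaw n m) - ∫ v : Fin n → Obs p,
      h (softMinMax b (0 + ∑ l, (√(n : ℝ))⁻¹ • v l) - √(n : ℝ) * theta m)
        ∂(Measure.pi fun _ => m)| ≤ Real.log p / b := by
  have hcont := hh.1.continuous
  rw [rootLaw, integral_map (measurable_root _).aemeasurable hcont.aestronglyMeasurable]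
  have isum : Integrable (fun y : Fin n → Obs p => ∑ l, (√(n : ℝ))⁻¹ • y l)
      (Measure.pi fun _ => m) :=
    integrable_finsetSum _ fun l _ =>
        (integrable_comp_eval (μ := fun _ : Fin n => m) (i := l) hm).smul (√(n : ℝ))⁻¹
  have h2 := integrable_of_abs_sub_le (continuous_test hh b (√(n : ℝ) * theta m))
    (fun s x => abs_test_sub_le hb hh _ (abs_apply_le_norm x)) isum 0
  have hd (v : Fin n → Obs p) : |h (√(n : ℝ) * (thetaHat v - theta m))
      - h (softMinMax b (0 + ∑ l, (√(n : ℝ))⁻¹ • v l) - √(n : ℝ) * theta m)|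
      ≤ Real.log p / b := by
    refine (abs_sub_le_of_mem_testClass hh _ _).trans ?_
    have := abs_softMinMax_sub_minMax_le hb (√(n : ℝ) • sampleMean v)
    rw [zero_add, ← sqrt_smul_sampleMean hn, abs_sub_comm]
    rw [minMax_smul (Real.sqrt_nonneg _)] at this
    refine (le_of_eq ?_).trans this
    congr 1
    simp only [thetaHat]
    ring
  have h1 : Integrable (fun v : Fin n → Obs p => h (√(n : ℝ) * (thetaHat v - theta m)))
      (Measure.pi fun _ => m) := by
    refine ((integrable_const (Real.log p / b)).add h2.norm).mono'
      (hcont.measurable.comp (measurable_root _)).aestronglyMeasurable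
      (Eventually.of_forall fun v => ?_)
    have h3 := abs_sub_abs_le_abs_sub (h (√(n : ℝ) * (thetaHat v - theta m)))
      (h (softMinMax b (0 + ∑ l, (√(n : ℝ))⁻¹ • v l) - √(n : ℝ) * theta m))
    have := hd v
    simp only [Real.norm_eq_abs, Pi.add_apply]
    linarith
  rw [← integral_sub h1 h2]
  rw [← Real.norm_eq_abs]
  exact (norm_integral_le_of_norm_le_const (Eventually.of_forall hd)).trans_eq (by simp)

/-- A third order Lindeberg bound for the min-max estimator. -/
theorem dF_rootLaw_le {n : ℕ} (hn : n ≠ 0) (hb : 1 ≤ b) {D : ℝ}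
    (hm₁ : Integrable (fun y => ‖y‖ ^ 3) m₁) (hm₂ : Integrable (fun y => ‖y‖ ^ 3) m₂)
    (hmean : meanOf m₁ = meanOf m₂)
    (hD : ∀ i j k l, |∫ y, y i j * y k l ∂m₁ - ∫ y, y i j * y k l ∂m₂| ≤ D) :
    dF (rootLaw n m₁) (rootLaw n m₂) ≤ ENNReal.ofReal (2 * (Real.log p / b) + 3 * b * D
      + 37 * b ^ 2 / √(n : ℝ) * (∫ y, ‖y‖ ^ 3 ∂m₁ + ∫ y, ‖y‖ ^ 3 ∂m₂)) := by
  refine iSup₂_le fun h hh => ENNReal.ofReal_le_ofReal ?_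
  have hb0 : 0 < b := one_pos.trans_le hb
  have hi {m : Measure (Obs p)} [IsProbabilityMeasure m] (hm : Integrable (fun y => ‖y‖ ^ 3) m) :
      Integrable (fun y => y) m := by
    have : Integrable (fun y => ‖y‖ ^ 1) m := integrable_norm_pow_of_le (by norm_num) hm
    simp only [pow_one] at this
    exact (integrable_norm_iff (by fun_prop)).1 this
  have h1 := abs_integral_rootLaw_sub_le hn hb0 hh (hi hm₁)
  have h2 := abs_integral_rootLaw_sub_le hn hb0 hh (hi hm₂)
  rw [← theta_eq_of_meanOf_eq hmean] at h2
  have h3 := abs_integral_sum_sub_le (continuous_test hh b (√(n : ℝ) * theta m₁))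
    (fun s x => abs_test_sub_le hb0 hh _ (abs_apply_le_norm x)) (hi hm₁) (hi hm₂)
    (fun s => abs_integral_test_sub_le hb hh (√(n : ℝ) * theta m₁) s
      (inv_nonneg.2 (Real.sqrt_nonneg n)) hm₁ hm₂ hmean hD) n 0
  have hn0 : (0 : ℝ) < n := by positivity
  have hsq : (n : ℝ) = √(n : ℝ) ^ 2 := (Real.sq_sqrt hn0.le).symm
  have hs : 0 < √(n : ℝ) := Real.sqrt_pos.2 hn0
  -- With `r = 1 / √n`, the `n` exchanges give `n * r ^ 2 = 1` and `n * r ^ 3 = 1 / √n`.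
  have e : (n : ℝ) * ((√(n : ℝ))⁻¹ ^ 2 * (3 * b * D)
        + 37 * b ^ 2 * (√(n : ℝ))⁻¹ ^ 3 * (∫ y, ‖y‖ ^ 3 ∂m₁ + ∫ y, ‖y‖ ^ 3 ∂m₂))
      = 3 * b * D + 37 * b ^ 2 / √(n : ℝ) * (∫ y, ‖y‖ ^ 3 ∂m₁ + ∫ y, ‖y‖ ^ 3 ∂m₂) := by
    nth_rewrite 1 [hsq]
    field_simp
  rw [e] at h3
  rw [abs_le] at h1 h2 h3
  linarith

end Compare

/-! ### A maximal inequality with log-sum-exp as potential. -/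

section MaximalInequality

variable {ι : Type*} [Fintype ι] {c : ℝ}

lemma lse_line [Nonempty ι] (hc : 0 < c) (s x : ι → ℝ) (t : ℝ) :
    HasDerivAt (fun t : ℝ => lse c (s + t • x)) (gibbs (fun i => c * (s + t • x) i) x) t :=
  hasDerivAt_lse hc fun i => by simpa using ((hasDerivAt_id t).mul_const (x i)).const_add (s i)

lemma abs_lse_add_sub_le [Nonempty ι] (hc : 0 < c) (s x : ι → ℝ) :
    |lse c (s + x) - lse c s| ≤ ‖x‖ := by
  have := norm_image_sub_le_of_norm_deriv_le_segment_01'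
    (f := fun t : ℝ => lse c (s + t • x)) (C := ‖x‖)
    (fun t _ => (lse_line hc s x t).hasDerivWithinAt)
    (fun t _ => abs_gibbs_le _ (norm_le_pi_norm x))
  simpa using this

/-- The second derivative along the line is `c` times a Gibbs variance. The linear term is a Gibbs
average of `x`, so it vanishes in expectation for a centered increment. -/
lemma lse_add_le [Nonempty ι] (hc : 0 < c) (s x : ι → ℝ) :
    lse c (s + x) ≤ lse c s + gibbs (fun i => c * s i) x + 2 * c * ‖x‖ ^ 2 := by
  have hd (t : ℝ) : HasDerivAt (fun t : ℝ => gibbs (fun i => c * (s + t • x) i) x)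
      (c * (gibbs (fun i => c * (s + t • x) i) (fun i => x i * x i)
        - gibbs (fun i => c * (s + t • x) i) x * gibbs (fun i => c * (s + t • x) i) x)) t := by
    have := hasDerivAt_gibbs (g := fun t i => c * (s + t • x) i) (u := fun _ => x)
      (g' := fun j => c * x j) (u' := fun _ => 0) (t := t)
      (fun i => HasDerivAt.const_mul c (by
        simpa using ((hasDerivAt_id t).mul_const (x i)).const_add (s i)))
      (fun j => hasDerivAt_const _ _)
    refine this.congr_deriv ?_
    simp only [gibbs_zero, mul_assoc, gibbs_const_mul]
    ring
  have hb (t : ℝ) : |c * (gibbs (fun i => c * (s + t • x) i) (fun i => x i * x i)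
        - gibbs (fun i => c * (s + t • x) i) x * gibbs (fun i => c * (s + t • x) i) x)|
      ≤ 2 * c * ‖x‖ ^ 2 := by
    have hx : ∀ i, |x i| ≤ ‖x‖ := norm_le_pi_norm x
    refine (abs_const_mul_le_of_le hc.le (abs_sub_le_of_le
      (abs_gibbs_le _ fun i => abs_mul_le_of_le (hx i) (hx i))
      (abs_mul_le_of_le (abs_gibbs_le _ hx) (abs_gibbs_le _ hx)))).trans_eq ?_
    ring
  have key (t : ℝ) (ht : t ∈ Set.Icc (0 : ℝ) 1) :
      ‖gibbs (fun i => c * (s + t • x) i) x - gibbs (fun i => c * s i) x‖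
        ≤ 2 * c * ‖x‖ ^ 2 := by
    have := norm_image_sub_le_of_norm_deriv_le_segment' (a := 0) (b := t)
      (fun s _ => (hd s).hasDerivWithinAt) (fun s _ => hb s) t ⟨ht.1, le_rfl⟩
    simp only [zero_smul, add_zero, sub_zero] at this
    exact this.trans (mul_le_of_le_one_right (by positivity) ht.2)
  have := norm_image_sub_le_of_norm_deriv_le_segment_01'
    (f := fun t : ℝ => lse c (s + t • x) - t * gibbs (fun i => c * s i) x)
    (fun t _ => ((lse_line hc s x t).sub
      (by simpa using (hasDerivAt_id t).mul_const (gibbs (fun i => c * s i) x))).hasDerivWithinAt)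
    (fun t ht => key t (Set.Ico_subset_Icc_self ht))
  simp only [one_smul, one_mul, zero_smul, add_zero, zero_mul, sub_zero, Real.norm_eq_abs] at this
  linarith [(abs_le.1 this).2]

variable {E : Type*} [MeasurableSpace E] {m : Measure E} [IsProbabilityMeasure m]
  {φ : E → ι → ℝ}

/-- Each independent centered increment raises the expected potential by at most its second order
term, whatever the current base point; induction on the number of increments adds these up. -/
lemma integral_lse_sum_le [Nonempty ι] (hc : 0 < c) (hφ : Integrable φ m)
    (hφ2 : Integrable (fun y => ‖φ y‖ ^ 2) m) (hmean : ∀ i, ∫ y, φ y i ∂m = 0) (r : ℝ) (n : ℕ)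
    (s : ι → ℝ) :
    ∫ y : Fin n → E, lse c (s + ∑ l, r • φ (y l)) ∂(Measure.pi fun _ => m)
      ≤ lse c s + n * (2 * c * r ^ 2 * ∫ y, ‖φ y‖ ^ 2 ∂m) := by
  induction n generalizing s with
  | zero => simp
  | succ n ih =>
    have hs : Integrable (fun y => lse c (s + r • φ y)) m :=
      integrable_of_abs_sub_le (continuous_lse c) (abs_lse_add_sub_le hc) (hφ.smul r) s
    have hsum : Integrable (fun y : Fin n → E => ∑ l, r • φ (y l)) (Measure.pi fun _ => m) :=
      integrable_finsetSum _ fun l _ =>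
        (integrable_comp_eval (μ := fun _ : Fin n => m) (i := l) hφ).smul r
    have hprod : Integrable (fun z : E × (Fin n → E) =>
        lse c (s + (r • φ z.1 + ∑ l, r • φ (z.2 l)))) (m.prod (Measure.pi fun _ => m)) :=
      integrable_of_abs_sub_le (continuous_lse c) (abs_lse_add_sub_le hc)
        (((hφ.smul r).comp_fst _).add (hsum.comp_snd m)) s
    have hφi (i : ι) : Integrable (fun y => (r • φ y) i) m := (hφ.eval i).const_mul r
    have hg := integrable_gibbs (m := m) (fun i => c * s i) hφi
    have hg0 : ∫ y, gibbs (fun i => c * s i) (r • φ y) ∂m = 0 := by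
      rw [integral_gibbs _ hφi]
      simp [integral_const_mul, hmean, gibbs_zero]
    have hone : ∫ y, lse c (s + r • φ y) ∂m
        ≤ lse c s + 2 * c * r ^ 2 * ∫ y, ‖φ y‖ ^ 2 ∂m := by
      calc ∫ y, lse c (s + r • φ y) ∂m
          ≤ ∫ y, (lse c s + gibbs (fun i => c * s i) (r • φ y)
              + 2 * c * r ^ 2 * ‖φ y‖ ^ 2) ∂m := by
            refine integral_mono hs (((integrable_const _).add hg).add (hφ2.const_mul _))
              fun y => ?_
            refine (lse_add_le hc s (r • φ y)).trans_eq ?_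
            rw [norm_smul, mul_pow, Real.norm_eq_abs, sq_abs]
            ring
        _ = _ := by
            have h1 : Integrable (fun y => lse c s + gibbs (fun i => c * s i) (r • φ y)) m :=
              (integrable_const _).add hg
            rw [integral_add h1 (hφ2.const_mul _), integral_add (integrable_const _) hg, hg0,
              integral_const_mul]
            simp
    calc ∫ y : Fin (n + 1) → E, lse c (s + ∑ l, r • φ (y l)) ∂(Measure.pi fun _ => m)
        = ∫ y, ∫ y' : Fin n → E, lse c (s + (r • φ y + ∑ l, r • φ (y' l)))
            ∂(Measure.pi fun _ => m) ∂m := by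
          rw [integral_pi_succ, ← integral_prod _ hprod]
          simp [Fin.sum_univ_succ]
      _ ≤ ∫ y, (lse c (s + r • φ y) + n * (2 * c * r ^ 2 * ∫ y, ‖φ y‖ ^ 2 ∂m)) ∂m := by
          refine integral_mono hprod.integral_prod_left (hs.add (integrable_const _)) fun y => ?_
          simpa only [add_assoc] using ih (s + r • φ y)
      _ = ∫ y, lse c (s + r • φ y) ∂m + n * (2 * c * r ^ 2 * ∫ y, ‖φ y‖ ^ 2 ∂m) := by
          rw [integral_add hs (integrable_const _)]
          simp
      _ ≤ _ := by
          push_cast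
          linarith

/-- A maximal inequality of Nemirovski type for the mean of independent centered vectors. -/
theorem integral_norm_mean_le [Nonempty ι] (hc : 0 < c) (hφ : Integrable φ m)
    (hφ2 : Integrable (fun y => ‖φ y‖ ^ 2) m) (hmean : ∀ i, ∫ y, φ y i ∂m = 0) {n : ℕ}
    (hn : n ≠ 0) :
    ∫ y : Fin n → E, ‖∑ l, (n : ℝ)⁻¹ • φ (y l)‖ ∂(Measure.pi fun _ => m)
      ≤ (Real.log (2 * Fintype.card ι) / c + 2 * c * ∫ y, ‖φ y‖ ^ 2 ∂m) / √(n : ℝ) := by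
  -- Doubling the index set with both signs makes the potential dominate the sup norm and not just
  -- the maximum.
  set ψ : E → ι ⊕ ι → ℝ := fun y => Sum.elim (φ y) (-φ y) with hψdef
  have hnorm (y : E) : ‖ψ y‖ = ‖φ y‖ := by
    refine le_antisymm ((pi_norm_le_iff_of_nonneg (norm_nonneg _)).2 ?_)
      ((pi_norm_le_iff_of_nonneg (norm_nonneg _)).2 fun i => norm_le_pi_norm (ψ y) (Sum.inl i))
    rintro (i | i)
    · exact norm_le_pi_norm (φ y) i
    · simpa [hψdef] using norm_le_pi_norm (φ y) i
  have hψ : Integrable ψ m := by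
    refine Integrable.of_eval ?_
    rintro (i | i)
    · exact hφ.eval i
    · exact (hφ.eval i).neg
  have hψ2 : Integrable (fun y => ‖ψ y‖ ^ 2) m := by simpa only [hnorm] using hφ2
  have hψm (i : ι ⊕ ι) : ∫ y, ψ y i ∂m = 0 := by
    rcases i with i | i
    · exact hmean i
    · simp [hψdef, integral_neg, hmean i]
  have hn0 : (0 : ℝ) < n := by positivity
  have hs : 0 < √(n : ℝ) := Real.sqrt_pos.2 hn0
  -- At inverse temperature `c * √n` the initial value of the potential and the accumulated
  -- increments are both of order `1 / √n`. The factor `c` stays free, to be tuned separately in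
  -- each application.
  have hcs : 0 < c * √(n : ℝ) := mul_pos hc hs
  have key := integral_lse_sum_le hcs hψ hψ2 hψm (n : ℝ)⁻¹ n 0
  have hsum {κ : Type _} [Fintype κ] {χ : E → κ → ℝ} (hχ : Integrable χ m) :
      Integrable (fun y : Fin n → E => ∑ l, (n : ℝ)⁻¹ • χ (y l)) (Measure.pi fun _ => m) :=
    integrable_finsetSum _ fun l _ =>
      (integrable_comp_eval (μ := fun _ : Fin n => m) (i := l) hχ).smul (n : ℝ)⁻¹
  have hle : ∫ y : Fin n → E, ‖∑ l, (n : ℝ)⁻¹ • φ (y l)‖ ∂(Measure.pi fun _ => m)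
      ≤ ∫ y : Fin n → E, lse (c * √(n : ℝ)) (0 + ∑ l, (n : ℝ)⁻¹ • ψ (y l))
        ∂(Measure.pi fun _ => m) := by
    refine integral_mono (hsum hφ).norm (integrable_of_abs_sub_le (continuous_lse _)
      (abs_lse_add_sub_le hcs) (hsum hψ) 0) fun y => ?_
    refine (pi_norm_le_iff_of_nonempty _).2 fun i => ?_
    have h1 := le_lse hcs (0 + ∑ l, (n : ℝ)⁻¹ • ψ (y l)) (Sum.inl i)
    have h2 := le_lse hcs (0 + ∑ l, (n : ℝ)⁻¹ • ψ (y l)) (Sum.inr i)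
    simp only [hψdef, zero_add, Finset.sum_apply, Pi.smul_apply, Sum.elim_inl, Sum.elim_inr,
      Pi.neg_apply, smul_neg, Finset.sum_neg_distrib] at h1 h2
    rw [Real.norm_eq_abs, abs_le]
    simp only [Finset.sum_apply, Pi.smul_apply, zero_add]
    constructor <;> linarith
  refine (hle.trans key).trans_eq ?_
  have e0 : lse (c * √(n : ℝ)) (0 : ι ⊕ ι → ℝ)
      = Real.log (2 * Fintype.card ι) / c / √(n : ℝ) := by
    simp only [lse, Pi.zero_apply, mul_zero, Real.exp_zero, Finset.sum_const, Finset.card_univ,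
      Fintype.card_sum, nsmul_eq_mul, mul_one]
    push_cast
    rw [← two_mul]
    field_simp
  have hsq : (n : ℝ) = √(n : ℝ) * √(n : ℝ) := (Real.mul_self_sqrt hn0.le).symm
  simp only [hnorm]
  rw [e0, add_div]
  congr 1
  have : (n : ℝ) * ((n : ℝ)⁻¹ ^ 2) = (√(n : ℝ))⁻¹ * (√(n : ℝ))⁻¹ := by
    rw [← mul_inv, ← hsq]
    field_simp
  calc (n : ℝ) * (2 * (c * √(n : ℝ)) * (n : ℝ)⁻¹ ^ 2 * ∫ y, ‖φ y‖ ^ 2 ∂m)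
      = ((n : ℝ) * ((n : ℝ)⁻¹ ^ 2)) * (2 * (c * √(n : ℝ)) * ∫ y, ‖φ y‖ ^ 2 ∂m) := by ring
    _ = _ := by
      rw [this]
      field_simp

end MaximalInequality

/-! ### Bootstrap and recentered laws for a fixed sample. -/

section Sample

variable {n p : ℕ}

/-- The centered entries of an observation. -/
def devMean (ν : Measure (Obs p)) (y : Obs p) : Fin p × Fin p → ℝ :=
  fun q => y q.1 q.2 - meanOf ν q.1 q.2

/-- The centered products of two entries of an observation. -/
def devSq (ν : Measure (Obs p)) (y : Obs p) : (Fin p × Fin p) × (Fin p × Fin p) → ℝ :=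
  fun q => y q.1.1 q.1.2 * y q.2.1 q.2.2 - ∫ z, z q.1.1 q.1.2 * z q.2.1 q.2.2 ∂ν

/-- The maximal error of the entries of the sample mean. -/
def meanErr (ν : Measure (Obs p)) (x : Fin n → Obs p) : ℝ := ‖∑ l, (n : ℝ)⁻¹ • devMean ν (x l)‖

/-- The maximal error of the empirical second moments. -/
def sqErr (ν : Measure (Obs p)) (x : Fin n → Obs p) : ℝ := ‖∑ l, (n : ℝ)⁻¹ • devSq ν (x l)‖

/-- The empirical `k`-th absolute moment. -/
def avgPow (k : ℕ) (x : Fin n → Obs p) : ℝ := ∑ l, (n : ℝ)⁻¹ * ‖x l‖ ^ k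

/-- A bound, depending on the sample, for the distance of the bootstrap from the truth. -/
def errBound (ν : Measure (Obs p)) (A b : ℝ) (x : Fin n → Obs p) : ℝ :=
  2 * (Real.log p / b) + 3 * b * (sqErr ν x + 2 * A * meanErr ν x + meanErr ν x ^ 2)
    + 37 * b ^ 2 / √(n : ℝ) * (4 * (avgPow 3 x + A + meanErr ν x ^ 3))

lemma sum_inv_card (hn : n ≠ 0) : ∑ _l : Fin n, (n : ℝ)⁻¹ = 1 := by
  have : (n : ℝ) ≠ 0 := by exact_mod_cast hn
  simp [this]

lemma abs_sampleMean_sub_le (hn : n ≠ 0) (ν : Measure (Obs p)) (x : Fin n → Obs p)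
    (i j : Fin p) : |sampleMean x i j - meanOf ν i j| ≤ meanErr ν x := by
  have := norm_le_pi_norm (∑ l, (n : ℝ)⁻¹ • devMean ν (x l)) (i, j)
  refine (le_of_eq ?_).trans this
  simp only [Finset.sum_apply, Pi.smul_apply, devMean, smul_eq_mul, mul_sub,
    Finset.sum_sub_distrib, ← Finset.sum_mul, sum_inv_card hn, ← Finset.mul_sum, sampleMean,
    one_div, one_mul, Real.norm_eq_abs]

lemma abs_sum_mul_sub_le (hn : n ≠ 0) (ν : Measure (Obs p)) (x : Fin n → Obs p)
    (i j k l : Fin p) :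
    |∑ r, (n : ℝ)⁻¹ * (x r i j * x r k l) - ∫ z, z i j * z k l ∂ν| ≤ sqErr ν x := by
  have := norm_le_pi_norm (∑ l, (n : ℝ)⁻¹ • devSq ν (x l)) ((i, j), (k, l))
  refine (le_of_eq ?_).trans this
  simp only [Finset.sum_apply, Pi.smul_apply, devSq, smul_eq_mul, mul_sub,
    Finset.sum_sub_distrib, ← Finset.sum_mul, sum_inv_card hn, one_mul, Real.norm_eq_abs]

lemma integrable_bootLaw (hn : n ≠ 0) (x : Fin n → Obs p) (f : Obs p → ℝ) :
    Integrable f (bootLaw x) := by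
  refine Integrable.smul_measure ?_ (by simpa using hn)
  refine integrable_finsetSum_measure.2 fun l _ => ?_
  exact integrable_dirac (by simp)

lemma integral_bootLaw (x : Fin n → Obs p) (f : Obs p → ℝ) :
    ∫ y, f y ∂(bootLaw x) = ∑ l, (n : ℝ)⁻¹ * f (x l) := by
  rw [bootLaw, integral_smul_measure, integral_finsetSum_measure
    fun l _ => integrable_dirac (by simp)]
  simp [Finset.mul_sum]

lemma isProbabilityMeasure_bootLaw (hn : n ≠ 0) (x : Fin n → Obs p) :
    IsProbabilityMeasure (bootLaw x) := by
  constructor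
  simp only [bootLaw, Measure.smul_apply, Measure.coe_finsetSum, Finset.sum_apply,
    measure_univ, Finset.sum_const, Finset.card_univ, Fintype.card_fin, smul_eq_mul, nsmul_eq_mul,
    mul_one]
  exact ENNReal.inv_mul_cancel (by simpa using hn) (by simp)

lemma integral_centeredBootLaw (ν : Measure (Obs p)) (x : Fin n → Obs p) {f : Obs p → ℝ}
    (hf : Measurable f) : ∫ y, f y ∂(centeredBootLaw ν x)
      = ∑ l, (n : ℝ)⁻¹ * f (x l - (sampleMean x - meanOf ν)) := by
  rw [centeredBootLaw, integral_map (by fun_prop) hf.aestronglyMeasurable, integral_bootLaw]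

lemma isProbabilityMeasure_centeredBootLaw (hn : n ≠ 0) (ν : Measure (Obs p))
    (x : Fin n → Obs p) : IsProbabilityMeasure (centeredBootLaw ν x) := by
  have := isProbabilityMeasure_bootLaw hn x
  exact Measure.isProbabilityMeasure_map (by fun_prop)

lemma recenteredLaw_eq (ν : Measure (Obs p)) (x : Fin n → Obs p) :
    recenteredLaw ν x = ν.map (fun y => y + (sampleMean x - meanOf ν)) := by
  simp only [recenteredLaw, add_sub_assoc]

lemma meanErr_nonneg (ν : Measure (Obs p)) (x : Fin n → Obs p) : 0 ≤ meanErr ν x := norm_nonneg _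

lemma sqErr_nonneg (ν : Measure (Obs p)) (x : Fin n → Obs p) : 0 ≤ sqErr ν x := norm_nonneg _

lemma norm_sampleMean_sub_le (hn : n ≠ 0) (ν : Measure (Obs p)) (x : Fin n → Obs p) :
    ‖sampleMean x - meanOf ν‖ ≤ meanErr ν x :=
  (pi_norm_le_iff_of_nonneg (meanErr_nonneg ν x)).2 fun i =>
    (pi_norm_le_iff_of_nonneg (meanErr_nonneg ν x)).2 fun j => abs_sampleMean_sub_le hn ν x i j

lemma norm_add_pow_three_le {V : Type*} [SeminormedAddCommGroup V] {y d : V} {T : ℝ}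
    (hd : ‖d‖ ≤ T) : ‖y + d‖ ^ 3 ≤ 4 * (‖y‖ ^ 3 + T ^ 3) := by
  calc ‖y + d‖ ^ 3 ≤ (‖y‖ + T) ^ 3 := by
        gcongr
        exact (norm_add_le _ _).trans (by gcongr)
    _ ≤ _ := by
        have := add_pow_le (norm_nonneg y) ((norm_nonneg d).trans hd) 3
        norm_num at this
        exact this

lemma abs_meanOf_le {ν : Measure (Obs p)} {A : ℝ} (hA : ∫ y, ‖y‖ ∂ν ≤ A)
    (hi : Integrable (fun y => ‖y‖) ν) (i j : Fin p) : |meanOf ν i j| ≤ A :=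
  (norm_integral_le_of_norm_le (f := fun y : Obs p => y i j) hi
    (Eventually.of_forall fun y => abs_apply_le_norm y i j)).trans hA

/-- Shifting the fresh observations to the sample mean and shifting the bootstrap back to the true
mean lead to the same expression for the difference of second moments. Here `s` is the error of the
raw second moment, `d` and `d'` are errors of means, and `μ`, `μ'` are true means. -/
lemma abs_covDiff_le {s d d' μ μ' W T A : ℝ} (hs : |s| ≤ W) (hd : |d| ≤ T) (hd' : |d'| ≤ T)
    (hμ : |μ| ≤ A) (hμ' : |μ'| ≤ A) :
    |s - d * μ' - μ * d' - d * d'| ≤ W + 2 * A * T + T ^ 2 := by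
  refine (abs_sub_le_of_le (abs_sub_le_of_le (abs_sub_le_of_le hs (abs_mul_le_of_le hd hμ'))
    (abs_mul_le_of_le hμ hd')) (abs_mul_le_of_le hd hd')).trans_eq ?_
  ring

variable [NeZero p] {ν : Measure (Obs p)} [IsProbabilityMeasure ν] {A b : ℝ}

/-- The shift gives the fresh observations the mean of the bootstrap law, so the first order terms
cancel. The sample is deterministic here: its randomness enters only when `errBound` is integrated.
-/
lemma dF_bootLaw_le (hn : n ≠ 0) (hb : 1 ≤ b) (hν : Integrable (fun y => ‖y‖ ^ 3) ν)
    (hA1 : ∫ y, ‖y‖ ∂ν ≤ A) (hA3 : ∫ y, ‖y‖ ^ 3 ∂ν ≤ A) (x : Fin n → Obs p) :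
    dF (rootLaw n (bootLaw x)) (rootLaw n (recenteredLaw ν x))
      ≤ ENNReal.ofReal (errBound ν A b x) := by
  have hP := isProbabilityMeasure_bootLaw hn x
  set d := sampleMean x - meanOf ν with hd
  have hmeas : Measurable (fun y : Obs p => y + d) := by fun_prop
  have hP2 : IsProbabilityMeasure (recenteredLaw ν x) := by
    rw [recenteredLaw_eq]
    exact Measure.isProbabilityMeasure_map hmeas.aemeasurable
  have hν1 : Integrable (fun y => ‖y‖) ν := by
    simpa using integrable_norm_pow_of_le (j := 1) (by norm_num) hν
  have hν2 : Integrable (fun y => ‖y‖ ^ 2) ν := integrable_norm_pow_of_le (by norm_num) hν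
  have he := integrable_entry hν1
  have hee := integrable_entry_mul hν2
  have hint {f : Obs p → ℝ} (hf : Measurable f) :
      ∫ y, f y ∂(recenteredLaw ν x) = ∫ y, f (y + d) ∂ν := by
    rw [recenteredLaw_eq, integral_map hmeas.aemeasurable hf.aestronglyMeasurable]
  have hmean : meanOf (bootLaw x) = meanOf (recenteredLaw ν x) := by
    funext i j
    simp only [meanOf]
    rw [integral_bootLaw, hint (by fun_prop)]
    simp only [Pi.add_apply]
    rw [integral_add (he i j) (integrable_const _)]
    simp [hd, sampleMean, meanOf, Finset.mul_sum]
  have h4 (y : Obs p) : ‖y + d‖ ^ 3 ≤ 4 * (‖y‖ ^ 3 + meanErr ν x ^ 3) :=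
    norm_add_pow_three_le (norm_sampleMean_sub_le hn ν x)
  have hi4 : Integrable (fun y => 4 * (‖y‖ ^ 3 + meanErr ν x ^ 3)) ν :=
    (hν.add (integrable_const _)).const_mul 4
  have hi3 : Integrable (fun y => ‖y + d‖ ^ 3) ν :=
    hi4.mono' (by fun_prop) (Eventually.of_forall fun y => by
      rw [Real.norm_of_nonneg (by positivity)]
      exact h4 y)
  have hm3 : Integrable (fun y => ‖y‖ ^ 3) (recenteredLaw ν x) := by
    rw [recenteredLaw_eq]
    exact (integrable_map_measure (by fun_prop) hmeas.aemeasurable).2 hi3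
  have h3 : ∫ y, ‖y‖ ^ 3 ∂(recenteredLaw ν x) ≤ 4 * (A + meanErr ν x ^ 3) := by
    rw [hint (by fun_prop)]
    refine (integral_mono hi3 hi4 h4).trans ?_
    rw [integral_const_mul, integral_add hν (integrable_const _)]
    simp only [integral_const, probReal_univ, one_smul]
    gcongr
  have h3' : ∫ y, ‖y‖ ^ 3 ∂(bootLaw x) = avgPow 3 x := integral_bootLaw x _
  have h30 : 0 ≤ avgPow 3 x := Finset.sum_nonneg fun l _ => by positivity
  refine (dF_rootLaw_le (D := sqErr ν x + 2 * A * meanErr ν x + meanErr ν x ^ 2) hn hb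
    (integrable_bootLaw hn x _) hm3 hmean ?_).trans (ENNReal.ofReal_le_ofReal ?_)
  · intro i j k l
    rw [integral_bootLaw, hint (by fun_prop)]
    have e : ∫ y : Obs p, (y + d) i j * (y + d) k l ∂ν
        = ∫ y : Obs p, y i j * y k l ∂ν + d i j * meanOf ν k l + meanOf ν i j * d k l
          + d i j * d k l := by
      have e1 (y : Obs p) : (y + d) i j * (y + d) k l
          = y i j * y k l + d i j * y k l + y i j * d k l + d i j * d k l := by
        simp only [Pi.add_apply]
        ring
      have i1 := hee i j k l
      have i2 := (he k l).const_mul (d i j)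
      have i3 := (he i j).mul_const (d k l)
      have i12 : Integrable (fun y : Obs p => y i j * y k l + d i j * y k l) ν := i1.add i2
      have i123 : Integrable (fun y : Obs p => y i j * y k l + d i j * y k l
        + y i j * d k l) ν := i12.add i3
      simp only [e1]
      rw [integral_add i123 (integrable_const _), integral_add i12 i3, integral_add i1 i2,
        integral_const_mul, integral_mul_const]
      simp [meanOf]
    rw [e]
    have := abs_covDiff_le (abs_sum_mul_sub_le hn ν x i j k l)
      (abs_sampleMean_sub_le hn ν x i j) (abs_sampleMean_sub_le hn ν x k l)
      (abs_meanOf_le hA1 hν1 i j) (abs_meanOf_le hA1 hν1 k l)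
    refine (le_of_eq ?_).trans this
    congr 1
    simp only [hd, Pi.sub_apply]
    ring
  · rw [h3', errBound]
    gcongr
    linarith

lemma dF_centeredBootLaw_le (hn : n ≠ 0) (hb : 1 ≤ b) (hν : Integrable (fun y => ‖y‖ ^ 3) ν)
    (hA1 : ∫ y, ‖y‖ ∂ν ≤ A) (hA3 : ∫ y, ‖y‖ ^ 3 ∂ν ≤ A) (x : Fin n → Obs p) :
    dF (rootLaw n (centeredBootLaw ν x)) (rootLaw n ν)
      ≤ ENNReal.ofReal (errBound ν A b x) := by
  have hP := isProbabilityMeasure_bootLaw hn x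
  have hP2 := isProbabilityMeasure_centeredBootLaw hn ν x
  set d := sampleMean x - meanOf ν with hd
  have hmeas : Measurable (fun y : Obs p => y - d) := by fun_prop
  have hν1 : Integrable (fun y => ‖y‖) ν := by
    simpa using integrable_norm_pow_of_le (j := 1) (by norm_num) hν
  have hX (i j : Fin p) : ∑ l, (n : ℝ)⁻¹ * x l i j = d i j + meanOf ν i j := by
    simp [hd, sampleMean, Finset.mul_sum]
  have hc (c : ℝ) : ∑ _l : Fin n, (n : ℝ)⁻¹ * c = c := by
    rw [← Finset.sum_mul, sum_inv_card hn, one_mul]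
  have hmean : meanOf (centeredBootLaw ν x) = meanOf ν := by
    funext i j
    rw [meanOf, integral_centeredBootLaw ν x (by fun_prop)]
    simp only [Pi.sub_apply, mul_sub, Finset.sum_sub_distrib, hX, hc]
    simp only [hd, Pi.sub_apply]
    ring
  have hm3 : Integrable (fun y => ‖y‖ ^ 3) (centeredBootLaw ν x) :=
    (integrable_map_measure (by fun_prop) hmeas.aemeasurable).2 (integrable_bootLaw hn x _)
  have h3 : ∫ y, ‖y‖ ^ 3 ∂(centeredBootLaw ν x) ≤ 4 * (avgPow 3 x + meanErr ν x ^ 3) := by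
    rw [integral_centeredBootLaw ν x (by fun_prop)]
    have h4 (l : Fin n) : ‖x l - d‖ ^ 3 ≤ 4 * (‖x l‖ ^ 3 + meanErr ν x ^ 3) := by
      rw [sub_eq_add_neg]
      exact norm_add_pow_three_le ((norm_neg d).trans_le (norm_sampleMean_sub_le hn ν x))
    refine (Finset.sum_le_sum fun l _ => mul_le_mul_of_nonneg_left (h4 l)
      (inv_nonneg.2 (Nat.cast_nonneg n))).trans_eq ?_
    simp only [mul_left_comm _ (4 : ℝ), ← Finset.mul_sum (a := (4 : ℝ)), mul_add,
      Finset.sum_add_distrib, hc, avgPow]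
  refine (dF_rootLaw_le (D := sqErr ν x + 2 * A * meanErr ν x + meanErr ν x ^ 2) hn hb
    hm3 hν hmean ?_).trans (ENNReal.ofReal_le_ofReal ?_)
  · intro i j k l
    rw [integral_centeredBootLaw ν x (by fun_prop)]
    have e : ∑ r, (n : ℝ)⁻¹ * ((x r - d) i j * (x r - d) k l)
        = ∑ r, (n : ℝ)⁻¹ * (x r i j * x r k l) - d i j * meanOf ν k l - meanOf ν i j * d k l
          - d i j * d k l := by
      have e1 (r : Fin n) : (n : ℝ)⁻¹ * ((x r - d) i j * (x r - d) k l)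
          = (n : ℝ)⁻¹ * (x r i j * x r k l) - d i j * ((n : ℝ)⁻¹ * x r k l)
            - ((n : ℝ)⁻¹ * x r i j) * d k l + (n : ℝ)⁻¹ * (d i j * d k l) := by
        simp only [Pi.sub_apply]
        ring
      rw [Finset.sum_congr rfl fun r _ => e1 r]
      simp only [Finset.sum_add_distrib, Finset.sum_sub_distrib, ← Finset.mul_sum (a := d i j),
        ← Finset.sum_mul, hX, hc]
      ring
    rw [e]
    have := abs_covDiff_le (abs_sum_mul_sub_le hn ν x i j k l)
      (abs_sampleMean_sub_le hn ν x i j) (abs_sampleMean_sub_le hn ν x k l)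
      (abs_meanOf_le hA1 hν1 i j) (abs_meanOf_le hA1 hν1 k l)
    refine (le_of_eq ?_).trans this
    congr 1
    simp only [hd, Pi.sub_apply]
    ring
  · rw [errBound]
    gcongr
    linarith [integral_nonneg (μ := ν) (f := fun y : Obs p => ‖y‖ ^ 3) fun y => by positivity]

end Sample

/-! ### Expectation of the data-dependent error. -/

section ErrBound

variable {n p : ℕ} {ν : Measure (Obs p)} {A b : ℝ}

lemma norm_devMean_le (hA : ∫ y, ‖y‖ ∂ν ≤ A) (hi : Integrable (fun y => ‖y‖) ν) (y : Obs p) :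
    ‖devMean ν y‖ ≤ ‖y‖ + A := by
  have hA0 : 0 ≤ A := (integral_nonneg fun y => norm_nonneg y).trans hA
  exact (pi_norm_le_iff_of_nonneg (by positivity)).2 fun q =>
    abs_sub_le_of_le (abs_apply_le_norm y q.1 q.2) (abs_meanOf_le hA hi q.1 q.2)

lemma norm_devSq_le (hA : ∫ y, ‖y‖ ^ 2 ∂ν ≤ A) (hi : Integrable (fun y => ‖y‖ ^ 2) ν)
    (y : Obs p) : ‖devSq ν y‖ ≤ ‖y‖ ^ 2 + A := by
  have hA0 : 0 ≤ A := (integral_nonneg fun y => by positivity).trans hA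
  have hm (z : Obs p) (q : (Fin p × Fin p) × (Fin p × Fin p)) :
      |z q.1.1 q.1.2 * z q.2.1 q.2.2| ≤ ‖z‖ ^ 2 :=
    (abs_mul_le_of_le (abs_apply_le_norm z q.1.1 q.1.2)
      (abs_apply_le_norm z q.2.1 q.2.2)).trans_eq (sq _).symm
  exact (pi_norm_le_iff_of_nonneg (by positivity)).2 fun q =>
    abs_sub_le_of_le (hm y q) ((norm_integral_le_of_norm_le
      (f := fun z : Obs p => z q.1.1 q.1.2 * z q.2.1 q.2.2) hi
      (Eventually.of_forall fun z => hm z q)).trans hA)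

lemma measurable_devMean : Measurable (devMean ν) := by
  unfold devMean
  fun_prop

lemma measurable_devSq : Measurable (devSq ν) := by
  unfold devSq
  fun_prop

lemma measurable_meanErr : Measurable (meanErr ν : (Fin n → Obs p) → ℝ) := by
  have := measurable_devMean (ν := ν)
  unfold meanErr
  fun_prop

/-- Jensen's inequality for the empirical average. There is no decay in `n`; it is used for
integrability and for higher powers that already carry a small factor. -/
lemma meanErr_pow_le (hn : n ≠ 0) (hA : ∫ y, ‖y‖ ∂ν ≤ A) (hi : Integrable (fun y => ‖y‖) ν)
    (x : Fin n → Obs p) (k : ℕ) : meanErr ν x ^ k ≤ 2 ^ (k - 1) * (avgPow k x + A ^ k) := by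
  have hA0 : 0 ≤ A := (integral_nonneg fun y => norm_nonneg y).trans hA
  have hn0 : 0 ≤ (n : ℝ)⁻¹ := by positivity
  have h1 : meanErr ν x ≤ ∑ l, (n : ℝ)⁻¹ * (‖x l‖ + A) := by
    refine (norm_sum_le _ _).trans (Finset.sum_le_sum fun l _ => ?_)
    rw [norm_smul, Real.norm_of_nonneg hn0]
    exact mul_le_mul_of_nonneg_left (norm_devMean_le hA hi _) hn0
  calc meanErr ν x ^ k ≤ (∑ l, (n : ℝ)⁻¹ * (‖x l‖ + A)) ^ k :=
        pow_le_pow_left₀ (meanErr_nonneg ν x) h1 k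
    _ ≤ ∑ l, (n : ℝ)⁻¹ * (‖x l‖ + A) ^ k :=
        Real.pow_arith_mean_le_arith_mean_pow _ _ _ (fun _ _ => hn0) (sum_inv_card hn)
          (fun _ _ => by positivity) k
    _ ≤ ∑ l, (n : ℝ)⁻¹ * (2 ^ (k - 1) * (‖x l‖ ^ k + A ^ k)) :=
        Finset.sum_le_sum fun l _ => mul_le_mul_of_nonneg_left
          (add_pow_le (norm_nonneg _) hA0 k) hn0
    _ = _ := by
        simp only [mul_left_comm _ ((2 : ℝ) ^ (k - 1)), mul_add, Finset.sum_add_distrib,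
          ← Finset.mul_sum (a := (2 : ℝ) ^ (k - 1)), ← Finset.sum_mul, sum_inv_card hn, one_mul,
          avgPow]

variable [IsProbabilityMeasure ν]

lemma integrable_avgPow {k : ℕ} (hk : Integrable (fun y => ‖y‖ ^ k) ν) :
    Integrable (avgPow k : (Fin n → Obs p) → ℝ) (Measure.pi fun _ => ν) :=
  integrable_finsetSum _ fun l _ =>
    (integrable_comp_eval (μ := fun _ : Fin n => ν) (i := l) hk).const_mul (n : ℝ)⁻¹

lemma integral_avgPow (hn : n ≠ 0) {k : ℕ} (hk : Integrable (fun y => ‖y‖ ^ k) ν) :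
    ∫ x : Fin n → Obs p, avgPow k x ∂(Measure.pi fun _ => ν) = ∫ y, ‖y‖ ^ k ∂ν := by
  simp only [avgPow]
  rw [integral_finsetSum _ fun l _ =>
    (integrable_comp_eval (μ := fun _ : Fin n => ν) (i := l) hk).const_mul (n : ℝ)⁻¹]
  have (l : Fin n) : ∫ x : Fin n → Obs p, (n : ℝ)⁻¹ * ‖x l‖ ^ k ∂(Measure.pi fun _ => ν)
      = (n : ℝ)⁻¹ * ∫ y, ‖y‖ ^ k ∂ν := by
    rw [integral_const_mul]
    congr 1
    exact integral_comp_eval (μ := fun _ : Fin n => ν) (i := l) (f := fun y : Obs p => ‖y‖ ^ k)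
      hk.1
  simp only [this]
  rw [← Finset.sum_mul, sum_inv_card hn, one_mul]

lemma integrable_meanErr_pow (hn : n ≠ 0) {k : ℕ} (hk0 : 1 ≤ k)
    (hk : Integrable (fun y => ‖y‖ ^ k) ν) :
    Integrable (fun x : Fin n → Obs p => meanErr ν x ^ k) (Measure.pi fun _ => ν) := by
  have hi : Integrable (fun y => ‖y‖) ν := by
    simpa using integrable_norm_pow_of_le hk0 hk
  refine (((integrable_avgPow hk).add (integrable_const
    ((∫ y, ‖y‖ ∂ν) ^ k))).const_mul (2 ^ (k - 1))).mono'
    (measurable_meanErr.pow_const k).aestronglyMeasurable (Eventually.of_forall fun x => ?_)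
  rw [Real.norm_of_nonneg (pow_nonneg (meanErr_nonneg ν x) k)]
  exact meanErr_pow_le hn le_rfl hi x k

lemma integral_meanErr_pow_le (hn : n ≠ 0) {k : ℕ} (hk0 : 1 ≤ k)
    (hk : Integrable (fun y => ‖y‖ ^ k) ν) (hA : ∫ y, ‖y‖ ∂ν ≤ A) :
    ∫ x : Fin n → Obs p, meanErr ν x ^ k ∂(Measure.pi fun _ => ν)
      ≤ 2 ^ (k - 1) * (∫ y, ‖y‖ ^ k ∂ν + A ^ k) := by
  have hi : Integrable (fun y => ‖y‖) ν := by
    simpa using integrable_norm_pow_of_le hk0 hk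
  refine (integral_mono (integrable_meanErr_pow hn hk0 hk)
    (((integrable_avgPow hk).add (integrable_const (A ^ k))).const_mul (2 ^ (k - 1)))
    (meanErr_pow_le hn hA hi · k)).trans_eq ?_
  rw [integral_const_mul]
  simp only [Pi.add_apply]
  rw [integral_add (integrable_avgPow hk) (integrable_const _), integral_avgPow hn hk]
  simp

/-- Common input to the maximal inequality for the entries (`k = 1`) and for their products (`k =
2`); the latter requires fourth moments. -/
lemma integral_norm_sq_le {κ : Type*} [Fintype κ] {φ : Obs p → κ → ℝ} {k : ℕ}
    (hφ : Measurable φ) (hk : Integrable (fun y => ‖y‖ ^ (k * 2)) ν)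
    (hle : ∀ y, ‖φ y‖ ≤ ‖y‖ ^ k + A) (hA1 : 1 ≤ A) (hA : ∫ y, ‖y‖ ^ (k * 2) ∂ν ≤ A) :
    Integrable φ ν ∧ Integrable (fun y => ‖φ y‖ ^ 2) ν ∧ ∫ y, ‖φ y‖ ^ 2 ∂ν ≤ 4 * A ^ 2 := by
  have h1 (y : Obs p) : ‖φ y‖ ^ 2 ≤ 2 * (‖y‖ ^ (k * 2) + A ^ 2) := by
    have h := add_pow_le (pow_nonneg (norm_nonneg y) k) (zero_le_one.trans hA1) 2
    rw [← pow_mul] at h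
    norm_num at h
    exact (pow_le_pow_left₀ (norm_nonneg _) (hle y) 2).trans h
  have hi : Integrable (fun y => 2 * (‖y‖ ^ (k * 2) + A ^ 2)) ν :=
    (hk.add (integrable_const _)).const_mul 2
  have h2 : Integrable (fun y => ‖φ y‖ ^ 2) ν :=
    hi.mono' (hφ.norm.pow_const 2).aestronglyMeasurable (Eventually.of_forall fun y => by
      rw [Real.norm_of_nonneg (by positivity)]
      exact h1 y)
  refine ⟨?_, h2, ?_⟩
  · refine ((integrable_const (1 : ℝ)).add h2).mono' hφ.aestronglyMeasurable
      (Eventually.of_forall fun y => ?_)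
    simpa using pow_le_one_add_pow (norm_nonneg (φ y)) one_le_two
  · refine (integral_mono h2 hi h1).trans ?_
    rw [integral_const_mul, integral_add hk (integrable_const _)]
    simp only [integral_const, probReal_univ, one_smul]
    nlinarith

variable [NeZero p]

lemma log_two_mul_card_le {κ : Type*} [Fintype κ] [Nonempty κ]
    (hκ : (Fintype.card κ : ℝ) ≤ (p : ℝ) ^ 4) :
    Real.log (2 * Fintype.card κ) ≤ 4 * (1 + Real.log p) := by
  have hp : (0 : ℝ) < p := by exact_mod_cast Nat.pos_of_ne_zero (NeZero.ne p)
  have hc : (0 : ℝ) < Fintype.card κ := by exact_mod_cast Fintype.card_pos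
  have h1 : Real.log (Fintype.card κ) ≤ 4 * Real.log p := by
    refine (Real.log_le_log hc hκ).trans_eq ?_
    rw [Real.log_pow]
    norm_num
  rw [Real.log_mul two_ne_zero hc.ne']
  linarith [Real.log_two_lt_d9]

lemma integral_meanErr_le (hn : n ≠ 0) (hν : Integrable (fun y => ‖y‖ ^ 4) ν)
    (hA : ∀ k ≤ 4, ∫ y, ‖y‖ ^ k ∂ν ≤ A) {c : ℝ} (hc : 0 < c) :
    ∫ x : Fin n → Obs p, meanErr ν x ∂(Measure.pi fun _ => ν)
      ≤ (4 * (1 + Real.log p) / c + 8 * c * A ^ 2) / √(n : ℝ) := by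
  -- The case `k = 0` of the moment bound says `1 ≤ A`, because `ν` has mass one.
  have hA1 : 1 ≤ A := by simpa using hA 0 (by norm_num)
  have hi : Integrable (fun y => ‖y‖) ν := by
    simpa using integrable_norm_pow_of_le (j := 1) (by norm_num) hν
  have hp : (1 : ℝ) ≤ p := by exact_mod_cast Nat.pos_of_ne_zero (NeZero.ne p)
  obtain ⟨h1, h2, h3⟩ := integral_norm_sq_le (φ := devMean ν) (k := 1) (A := A)
    measurable_devMean (integrable_norm_pow_of_le (by norm_num) hν)
    (fun y => by simpa using norm_devMean_le (by simpa using hA 1 (by norm_num)) hi y) hA1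
    (hA _ (by norm_num))
  refine (integral_norm_mean_le hc h1 h2 (fun q => ?_) hn).trans ?_
  · simp only [devMean]
    rw [integral_sub (integrable_entry hi _ _) (integrable_const _)]
    simp [meanOf]
  · have h4 : Real.log (2 * Fintype.card (Fin p × Fin p)) ≤ 4 * (1 + Real.log p) := by
      refine log_two_mul_card_le ?_
      simp only [Fintype.card_prod, Fintype.card_fin, Nat.cast_mul]
      nlinarith [pow_le_pow_right₀ hp (show 2 ≤ 4 by norm_num)]
    gcongr ?_ / _
    refine add_le_add (by gcongr) ?_
    nlinarith

lemma integral_sqErr_le (hn : n ≠ 0) (hν : Integrable (fun y => ‖y‖ ^ 4) ν)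
    (hA : ∀ k ≤ 4, ∫ y, ‖y‖ ^ k ∂ν ≤ A) {c : ℝ} (hc : 0 < c) :
    Integrable (fun x : Fin n → Obs p => sqErr ν x) (Measure.pi fun _ => ν) ∧
    ∫ x : Fin n → Obs p, sqErr ν x ∂(Measure.pi fun _ => ν)
      ≤ (4 * (1 + Real.log p) / c + 8 * c * A ^ 2) / √(n : ℝ) := by
  have hA1 : 1 ≤ A := by simpa using hA 0 (by norm_num)
  have hi : Integrable (fun y => ‖y‖ ^ 2) ν := integrable_norm_pow_of_le (by norm_num) hν
  have hp : (1 : ℝ) ≤ p := by exact_mod_cast Nat.pos_of_ne_zero (NeZero.ne p)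
  obtain ⟨h1, h2, h3⟩ := integral_norm_sq_le (φ := devSq ν) (k := 2) (A := A)
    measurable_devSq (integrable_norm_pow_of_le (by norm_num) hν)
    (norm_devSq_le (hA 2 (by norm_num)) hi) hA1 (hA _ (by norm_num))
  refine ⟨Integrable.norm (integrable_finsetSum _ fun l _ => (integrable_comp_eval
    (μ := fun _ : Fin n => ν) (i := l) h1).smul (n : ℝ)⁻¹),
    (integral_norm_mean_le hc h1 h2 (fun q => ?_) hn).trans ?_⟩
  · simp only [devSq]
    rw [integral_sub (integrable_entry_mul hi _ _ _ _) (integrable_const _)]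
    simp
  · have h4 : Real.log (2 * Fintype.card ((Fin p × Fin p) × (Fin p × Fin p)))
        ≤ 4 * (1 + Real.log p) := by
      refine log_two_mul_card_le (le_of_eq ?_)
      simp only [Fintype.card_prod, Fintype.card_fin, Nat.cast_mul]
      ring
    gcongr ?_ / _
    refine add_le_add (by gcongr) ?_
    nlinarith

/-- Truncation at level `t`: below it `s ^ 2 ≤ t * s`, above it `s ^ 2 ≤ s ^ 4 / t ^ 2`. This bounds
the mean square of `meanErr` by the first-moment maximal inequality and a crude fourth moment. -/
lemma sq_le_mul_add_div {s t : ℝ} (hs : 0 ≤ s) (ht : 0 < t) : s ^ 2 ≤ t * s + s ^ 4 / t ^ 2 := by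
  rcases le_total s t with h | h
  · have : 0 ≤ s ^ 4 / t ^ 2 := by positivity
    nlinarith
  · have : s ^ 2 ≤ s ^ 4 / t ^ 2 := by
      rw [le_div_iff₀ (by positivity)]
      calc s ^ 2 * t ^ 2 ≤ s ^ 2 * s ^ 2 := by gcongr
        _ = s ^ 4 := by ring
    nlinarith

/-- The hypothesis on `b ^ 3` equates the smoothing error `(1 + log p) / b` with the Lindeberg
remainder `b ^ 2 / √n`. The moment errors join this order once the maximal inequality is used with
`c = b`, where `1 + log p ≤ b ^ 2` absorbs the logarithm. -/
theorem integral_errBound_le (hn : n ≠ 0) (hν : Integrable (fun y => ‖y‖ ^ 4) ν)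
    (hA : ∀ k ≤ 4, ∫ y, ‖y‖ ^ k ∂ν ≤ A) (hb : 1 ≤ b)
    (hb3 : b ^ 3 = (1 + Real.log p) * √(n : ℝ)) (hb2 : 1 + Real.log p ≤ b ^ 2) :
    Integrable (fun x : Fin n → Obs p => errBound ν A b x) (Measure.pi fun _ => ν) ∧
    ∫ x : Fin n → Obs p, errBound ν A b x ∂(Measure.pi fun _ => ν)
      ≤ 2000 * A ^ 4 * (b ^ 2 / √(n : ℝ)) := by
  have hA1 : 1 ≤ A := by simpa using hA 0 (by norm_num)
  have hn0 : (0 : ℝ) < n := by positivity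
  have hs : 0 < √(n : ℝ) := Real.sqrt_pos.2 hn0
  have hb0 : 0 < b := one_pos.trans_le hb
  have hA1' : ∫ y, ‖y‖ ∂ν ≤ A := by simpa using hA 1 (by norm_num)
  set L := 1 + Real.log p with hL
  set r := b ^ 2 / √(n : ℝ) with hr
  set t := √(√(n : ℝ) / b) with ht
  have ht0 : 0 < t := Real.sqrt_pos.2 (by positivity)
  have ht2 : t ^ 2 = √(n : ℝ) / b := Real.sq_sqrt (by positivity)
  have hν3 : Integrable (fun y => ‖y‖ ^ 3) ν := integrable_norm_pow_of_le (by norm_num) hν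
  have hν2 : Integrable (fun y => ‖y‖ ^ 2) ν := integrable_norm_pow_of_le (by norm_num) hν
  have hν1 : Integrable (fun y => ‖y‖ ^ 1) ν := integrable_norm_pow_of_le (by norm_num) hν
  have iT : Integrable (fun x : Fin n → Obs p => meanErr ν x) (Measure.pi fun _ => ν) := by
    simpa using integrable_meanErr_pow hn le_rfl hν1
  have iT2 := integrable_meanErr_pow hn (by norm_num) hν2
  have iT3 := integrable_meanErr_pow hn (by norm_num) hν3
  have iT4 := integrable_meanErr_pow hn (by norm_num) hν
  obtain ⟨iW, hW⟩ := integral_sqErr_le hn hν hA hb0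
  have hT := integral_meanErr_le hn hν hA hb0
  have hTt := integral_meanErr_le hn hν hA (div_pos hb0 ht0)
  have hT3 := integral_meanErr_pow_le hn (by norm_num) hν3 hA1'
  have hT4 := integral_meanErr_pow_le hn (by norm_num) hν hA1'
  have iN := integrable_avgPow (n := n) hν3
  have hN := integral_avgPow hn hν3
  have h3 := hA 3 (by norm_num)
  have h4 := hA 4 (by norm_num)
  have hp2 : A ≤ A ^ 2 := by nlinarith
  have hp3 : A ^ 2 ≤ A ^ 3 := pow_le_pow_right₀ hA1 (by norm_num)
  have hp4 : A ^ 3 ≤ A ^ 4 := pow_le_pow_right₀ hA1 (by norm_num)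
  have hr0 : 0 ≤ r := by positivity
  have hLr : L / b = r := by
    rw [hr, div_eq_div_iff hb0.ne' hs.ne', ← hb3]
    ring
  have hlog : Real.log p / b ≤ r := by
    rw [← hLr]
    gcongr
    linarith
  have bound (E : ℝ) (hE : E ≤ (4 * L / b + 8 * b * A ^ 2) / √(n : ℝ)) : b * E ≤ 12 * A ^ 2 * r := by
    calc b * E ≤ b * ((4 * L / b + 8 * b * A ^ 2) / √(n : ℝ)) := by gcongr
      _ = (4 * L + 8 * A ^ 2 * b ^ 2) / √(n : ℝ) := by field_simp
      _ ≤ (4 * (A ^ 2 * b ^ 2) + 8 * A ^ 2 * b ^ 2) / √(n : ℝ) := by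
          gcongr
          nlinarith
      _ = _ := by
          rw [hr]
          ring
  have bW := bound _ hW
  have bT := bound _ hT
  have bTt : b * (t * ∫ x : Fin n → Obs p, meanErr ν x ∂(Measure.pi fun _ => ν))
      ≤ 12 * A ^ 2 * r := by
    calc b * (t * ∫ x : Fin n → Obs p, meanErr ν x ∂(Measure.pi fun _ => ν))
        ≤ b * (t * ((4 * L / (b / t) + 8 * (b / t) * A ^ 2) / √(n : ℝ))) := by gcongr
      _ = (4 * (L * t ^ 2) + 8 * A ^ 2 * b ^ 2) / √(n : ℝ) := by field_simp
      _ = (4 * b ^ 2 + 8 * A ^ 2 * b ^ 2) / √(n : ℝ) := by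
          have : L * t ^ 2 = b ^ 2 := by
            rw [ht2, mul_div_assoc', ← hb3]
            field_simp
          rw [this]
      _ ≤ (4 * (A ^ 2 * b ^ 2) + 8 * A ^ 2 * b ^ 2) / √(n : ℝ) := by
          gcongr
          nlinarith [sq_nonneg b]
      _ = _ := by
          rw [hr]
          ring
  have bT4 : b * ((∫ x : Fin n → Obs p, meanErr ν x ^ 4 ∂(Measure.pi fun _ => ν)) / t ^ 2)
      ≤ 16 * A ^ 4 * r := by
    calc b * ((∫ x : Fin n → Obs p, meanErr ν x ^ 4 ∂(Measure.pi fun _ => ν)) / t ^ 2)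
        ≤ b * (16 * A ^ 4 / t ^ 2) := by
          gcongr
          norm_num at hT4
          linarith
      _ = _ := by
          rw [ht2, hr]
          field_simp
  have bT2 : b * ∫ x : Fin n → Obs p, meanErr ν x ^ 2 ∂(Measure.pi fun _ => ν)
      ≤ 12 * A ^ 2 * r + 16 * A ^ 4 * r := by
    have : ∫ x : Fin n → Obs p, meanErr ν x ^ 2 ∂(Measure.pi fun _ => ν)
        ≤ t * ∫ x : Fin n → Obs p, meanErr ν x ∂(Measure.pi fun _ => ν)
          + (∫ x : Fin n → Obs p, meanErr ν x ^ 4 ∂(Measure.pi fun _ => ν)) / t ^ 2 := by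
      rw [← integral_const_mul, ← integral_div,
        ← integral_add (iT.const_mul t) (iT4.div_const _)]
      exact integral_mono iT2 ((iT.const_mul t).add (iT4.div_const _)) fun x =>
        sq_le_mul_add_div (meanErr_nonneg ν x) ht0
    have := mul_le_mul_of_nonneg_left this hb0.le
    linarith
  have i1 : Integrable (fun x : Fin n → Obs p => sqErr ν x + 2 * A * meanErr ν x)
    (Measure.pi fun _ => ν) := iW.add (iT.const_mul _)
  have i2 : Integrable (fun x : Fin n → Obs p => sqErr ν x + 2 * A * meanErr ν x
    + meanErr ν x ^ 2) (Measure.pi fun _ => ν) := i1.add iT2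
  have i3 : Integrable (fun x : Fin n → Obs p => avgPow 3 x + A) (Measure.pi fun _ => ν) :=
    iN.add (integrable_const _)
  have i4 : Integrable (fun x : Fin n → Obs p => avgPow 3 x + A + meanErr ν x ^ 3)
    (Measure.pi fun _ => ν) := i3.add iT3
  have i5 : Integrable (fun x : Fin n → Obs p => 2 * (Real.log p / b) + 3 * b * (sqErr ν x
    + 2 * A * meanErr ν x + meanErr ν x ^ 2)) (Measure.pi fun _ => ν) :=
    (integrable_const _).add (i2.const_mul _)
  have i6 : Integrable (fun x : Fin n → Obs p =>
      37 * b ^ 2 / √(n : ℝ) * (4 * (avgPow 3 x + A + meanErr ν x ^ 3)))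
    (Measure.pi fun _ => ν) := (i4.const_mul 4).const_mul _
  refine ⟨i5.add i6, ?_⟩
  simp only [errBound]
  rw [integral_add i5 i6, integral_add (integrable_const _) (i2.const_mul _), integral_const_mul,
    integral_const_mul, integral_const_mul, integral_const_mul, integral_add i1 iT2,
    integral_add iW (iT.const_mul _),
    integral_const_mul, integral_add i3 iT3, integral_add iN (integrable_const _), hN]
  simp only [integral_const, probReal_univ, one_smul]
  norm_num at hT3
  have hl : 37 * b ^ 2 / √(n : ℝ) * (4 * (∫ y, ‖y‖ ^ 3 ∂ν + A
      + ∫ x : Fin n → Obs p, meanErr ν x ^ 3 ∂(Measure.pi fun _ => ν)))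
      ≤ 1480 * A ^ 4 * r := by
    calc _ = 37 * r * (4 * (∫ y, ‖y‖ ^ 3 ∂ν + A
          + ∫ x : Fin n → Obs p, meanErr ν x ^ 3 ∂(Measure.pi fun _ => ν))) := by
          rw [hr]
          ring
      _ ≤ 37 * r * (4 * (10 * A ^ 4)) := by
          gcongr
          linarith
      _ = _ := by ring
  have q1 : r ≤ A ^ 4 * r := le_mul_of_one_le_left hr0 (one_le_pow₀ hA1)
  have q2 : A ^ 2 * r ≤ A ^ 4 * r := by gcongr; linarith
  have q3 : A * (A ^ 2 * r) ≤ A ^ 4 * r := by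
    calc A * (A ^ 2 * r) = A ^ 3 * r := by ring
      _ ≤ _ := by gcongr
  have bTA := mul_le_mul_of_nonneg_left bT (zero_le_one.trans hA1)
  -- In units of `A ^ 4 * r` the pieces are `2` for smoothing, `3 * (12 + 24 + 28)` for second
  -- moments and `1480` for third moments, in total `1674`.
  nlinarith

end ErrBound

/-! ### From the norm assumption to moments. -/

lemma maxAbs_eq_norm {p : ℕ} (a : Obs p) : maxAbs a = ‖a‖ := by
  have h0 : 0 ≤ maxAbs a := Real.iSup_nonneg fun i => Real.iSup_nonneg fun j => abs_nonneg _
  refine le_antisymm (Real.iSup_le (fun i => Real.iSup_le (fun j => abs_apply_le_norm a i j)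
    (norm_nonneg _)) (norm_nonneg _)) ?_
  refine (pi_norm_le_iff_of_nonneg h0).2 fun i => (pi_norm_le_iff_of_nonneg h0).2 fun j => ?_
  exact (le_ciSup (f := fun j => |a i j|) (Set.finite_range _).bddAbove j).trans
    (le_ciSup (f := fun i => ⨆ j, |a i j|) (Set.finite_range _).bddAbove i)

lemma integral_norm_pow_le {p : ℕ} {ν : Measure (Obs p)} [IsProbabilityMeasure ν] {C : ℝ≥0}
    (h : eLpNorm (fun y : Obs p => ‖y‖) 12 ν ≤ C) :
    Integrable (fun y : Obs p => ‖y‖ ^ 12) ν ∧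
      ∀ k ≤ 12, ∫ y : Obs p, ‖y‖ ^ k ∂ν ≤ 1 + (C : ℝ) ^ 12 := by
  have hm : MemLp (fun y : Obs p => ‖y‖) 12 ν :=
    ⟨by fun_prop, h.trans_lt ENNReal.coe_lt_top⟩
  have hi : Integrable (fun y : Obs p => ‖y‖ ^ 12) ν := by
    have hm' : MemLp (fun y : Obs p => ‖y‖) ((12 : ℕ) : ℝ≥0∞) ν := by exact_mod_cast hm
    simpa using hm'.integrable_norm_pow (by norm_num)
  have h12 : ∫ y : Obs p, ‖y‖ ^ 12 ∂ν ≤ (C : ℝ) ^ 12 := by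
    rw [hm.eLpNorm_eq_integral_rpow_norm (by norm_num) (by norm_num),
      ← ENNReal.ofReal_coe_nnreal, ENNReal.ofReal_le_ofReal_iff C.coe_nonneg] at h
    have e : ∫ y : Obs p, ‖‖y‖‖ ^ (12 : ℝ≥0∞).toReal ∂ν = ∫ y : Obs p, ‖y‖ ^ 12 ∂ν := by
      refine integral_congr_ae (Eventually.of_forall fun y => ?_)
      simp only [norm_norm, ENNReal.toReal_ofNat]
      exact_mod_cast Real.rpow_natCast ‖y‖ 12
    rw [e] at h
    have h0 : 0 ≤ ∫ y : Obs p, ‖y‖ ^ 12 ∂ν := integral_nonneg fun y => by positivity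
    have h2 := pow_le_pow_left₀ (by positivity) h 12
    refine (le_of_eq ?_).trans h2
    rw [← Real.rpow_natCast, ← Real.rpow_mul h0]
    norm_num
  refine ⟨hi, fun k hk => ?_⟩
  calc ∫ y : Obs p, ‖y‖ ^ k ∂ν ≤ ∫ y : Obs p, (1 + ‖y‖ ^ 12) ∂ν :=
        integral_mono (integrable_norm_pow_of_le hk hi) ((integrable_const _).add hi)
          fun y => pow_le_one_add_pow (norm_nonneg y) hk
    _ = 1 + ∫ y : Obs p, ‖y‖ ^ 12 ∂ν := by
        rw [integral_add (integrable_const _) hi]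
        simp
    _ ≤ _ := by gcongr

/-! ### Choice of the temperature and asymptotics of the rate. -/

section Temperature

/-- The smoothing parameter balancing the two errors in the Lindeberg bound. -/
def temperature (n p : ℕ) : ℝ := ((1 + Real.log p) * √(n : ℝ)) ^ (1 / 3 : ℝ)

/-- The rate of convergence of the bootstrap. -/
def rate (n p : ℕ) : ℝ := temperature n p ^ 2 / √(n : ℝ)

variable {n p : ℕ}

lemma one_le_one_add_log (p : ℕ) : 1 ≤ 1 + Real.log p := by
  linarith [Real.log_natCast_nonneg p]

lemma temperature_nonneg (n p : ℕ) : 0 ≤ temperature n p := by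
  have := one_le_one_add_log p
  unfold temperature
  positivity

lemma rate_nonneg (n p : ℕ) : 0 ≤ rate n p := by
  unfold rate
  positivity

lemma temperature_pow_three (n p : ℕ) :
    temperature n p ^ 3 = (1 + Real.log p) * √(n : ℝ) := by
  have h0 : 0 ≤ (1 + Real.log p) * √(n : ℝ) := by
    have := one_le_one_add_log p
    positivity
  rw [temperature, ← Real.rpow_natCast, ← Real.rpow_mul h0]
  norm_num

lemma one_le_temperature (hn : n ≠ 0) (p : ℕ) : 1 ≤ temperature n p := by
  have h1 : (1 : ℝ) ≤ √(n : ℝ) := Real.one_le_sqrt.2 (by exact_mod_cast Nat.one_le_iff_ne_zero.2 hn)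
  exact Real.one_le_rpow (one_le_mul_of_one_le_of_one_le (one_le_one_add_log p) h1) (by norm_num)

lemma le_temperature_sq (h : 1 + Real.log p ≤ n) : 1 + Real.log p ≤ temperature n p ^ 2 := by
  have hL := one_le_one_add_log p
  refine (pow_le_pow_iff_left₀ (by linarith) (by positivity) (three_ne_zero)).1 ?_
  calc (1 + Real.log p) ^ 3 = (1 + Real.log p) ^ 2 * (1 + Real.log p) := by ring
    _ ≤ (1 + Real.log p) ^ 2 * n := by gcongr
    _ = (temperature n p ^ 3) ^ 2 := by
        rw [temperature_pow_three, mul_pow, Real.sq_sqrt (Nat.cast_nonneg n)]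
    _ = _ := by ring

lemma rate_pow_three (hn : n ≠ 0) (p : ℕ) : rate n p ^ 3 = (1 + Real.log p) ^ 2 / √(n : ℝ) := by
  have hs : 0 < √(n : ℝ) := Real.sqrt_pos.2 (by positivity)
  have : rate n p ^ 3 = (temperature n p ^ 3) ^ 2 / √(n : ℝ) ^ 3 := by
    rw [rate]
    ring
  rw [this, temperature_pow_three]
  field_simp

variable {p : ℕ → ℕ}

lemma isLittleO_one_add_log
    (hlog : (fun n : ℕ => Real.log (p n)) =o[atTop] (fun n : ℕ => (n : ℝ) ^ (1 / 4 : ℝ))) :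
    (fun n : ℕ => 1 + Real.log (p n)) =o[atTop] (fun n : ℕ => (n : ℝ) ^ (1 / 4 : ℝ)) := by
  refine IsLittleO.add ?_ hlog
  refine (isLittleO_const_left.2 (Or.inr ?_))
  refine tendsto_norm_atTop_atTop.comp ?_
  exact (tendsto_rpow_atTop (by norm_num)).comp tendsto_natCast_atTop_atTop

lemma eventually_one_add_log_le
    (hlog : (fun n : ℕ => Real.log (p n)) =o[atTop] (fun n : ℕ => (n : ℝ) ^ (1 / 4 : ℝ))) :
    ∀ᶠ n : ℕ in atTop, 1 + Real.log (p n) ≤ n := by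
  filter_upwards [(isLittleO_one_add_log hlog).bound one_pos, eventually_ge_atTop 1] with n h hn
  have hn1 : (1 : ℝ) ≤ n := by exact_mod_cast hn
  rw [one_mul, Real.norm_of_nonneg (zero_le_one.trans (one_le_one_add_log _)),
    Real.norm_of_nonneg (by positivity)] at h
  refine h.trans ((Real.rpow_le_rpow_of_exponent_le hn1
    (show (1 / 4 : ℝ) ≤ 1 by norm_num)).trans_eq (Real.rpow_one _))

/-- The cube of the rate is the square of `(1 + log p) / n ^ (1 / 4)`, which is where the growth
condition enters. -/
lemma tendsto_rate
    (hlog : (fun n : ℕ => Real.log (p n)) =o[atTop] (fun n : ℕ => (n : ℝ) ^ (1 / 4 : ℝ))) :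
    Tendsto (fun n => rate n (p n)) atTop (𝓝 0) := by
  have h1 := ((isLittleO_one_add_log hlog).tendsto_div_nhds_zero).pow 2
  have h2 := h1.rpow_const (p := (1 / 3 : ℝ)) (Or.inr (by norm_num))
  norm_num at h2
  refine h2.congr' ?_
  filter_upwards [eventually_ge_atTop 1] with n hn
  have e : ((1 + Real.log (p n)) / (n : ℝ) ^ (1 / 4 : ℝ)) ^ 2 = rate n (p n) ^ 3 := by
    rw [rate_pow_three (by omega), div_pow]
    congr 1
    rw [← Real.rpow_natCast, ← Real.rpow_mul (Nat.cast_nonneg n), Real.sqrt_eq_rpow]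
    norm_num
  rw [e, ← Real.rpow_natCast, ← Real.rpow_mul (rate_nonneg _ _)]
  norm_num

/-- The ninth root is the cube root of the rate, up to replacing `1 + log p` by `log p`. That
replacement needs `log p` bounded away from zero, hence `p ≥ 2`. -/
lemma tendsto_rate_div_pow_three (h2 : ∀ᶠ n in atTop, 2 ≤ p n) {ε : ℕ → ℝ} (hε : ∀ n, 0 < ε n)
    (ho : (fun n : ℕ => (Real.log (p n) ^ 2 / √(n : ℝ)) ^ (1 / 9 : ℝ)) =o[atTop] ε) :
    Tendsto (fun n => rate n (p n) / ε n ^ 3) atTop (𝓝 0) := by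
  have h3 := (ho.tendsto_div_nhds_zero.pow 3).const_mul 3
  norm_num at h3
  refine squeeze_zero' (Eventually.of_forall fun n =>
    div_nonneg (rate_nonneg _ _) (pow_nonneg (hε n).le 3)) ?_ h3
  filter_upwards [h2, eventually_ge_atTop 1] with n hp hn
  have hlog : Real.log 2 ≤ Real.log (p n) :=
    Real.log_le_log two_pos (by exact_mod_cast hp)
  have hl2 := Real.log_two_gt_d9
  set q := (Real.log (p n) ^ 2 / √(n : ℝ)) ^ (1 / 9 : ℝ) with hq
  have hq0 : 0 ≤ q := by positivity
  have hq9 : q ^ 9 = Real.log (p n) ^ 2 / √(n : ℝ) := by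
    rw [hq, ← Real.rpow_natCast, ← Real.rpow_mul (by positivity)]
    norm_num
  rw [div_pow, ← mul_div_assoc]
  have hε3 := pow_pos (hε n) 3
  gcongr
  refine (pow_le_pow_iff_left₀ (rate_nonneg _ _) (by positivity) three_ne_zero).1 ?_
  rw [rate_pow_three (by omega)]
  -- Since `log 2 > 1 / 2`, one has `1 ≤ 2 * log p`.
  calc (1 + Real.log (p n)) ^ 2 / √(n : ℝ) ≤ (3 * Real.log (p n)) ^ 2 / √(n : ℝ) := by
        gcongr
        linarith
    _ = 9 * q ^ 9 := by
        rw [hq9]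
        ring
    _ ≤ (3 * q ^ 3) ^ 3 := by
        have : 0 ≤ q ^ 9 := by positivity
        nlinarith

end Temperature

/-! ### From the product law to the random sample. -/

section Transfer

variable {n p : ℕ} {Ω : Type*} [MeasurableSpace Ω] {P : Measure Ω}
  {ν : Measure (Obs p)} {X : Fin n → Ω → Obs p} {C : ℝ≥0}

lemma hasLaw_sample [IsProbabilityMeasure P] (hlaw : ∀ l, HasLaw (X l) ν P) (hindep : iIndepFun X P) :
    HasLaw (fun ω l => X l ω) (Measure.pi fun _ => ν) P := by
  refine ⟨aemeasurable_pi_lambda _ fun l => (hlaw l).aemeasurable, ?_⟩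
  rw [(iIndepFun_iff_map_fun_eq_pi_map fun l => (hlaw l).aemeasurable).1 hindep]
  congr 1
  funext l
  exact (hlaw l).map_eq

lemma errBound_nonneg {A b : ℝ} (hA : 0 ≤ A) (hb : 0 ≤ b) (x : Fin n → Obs p) :
    0 ≤ errBound ν A b x := by
  have h1 := meanErr_nonneg ν x
  have h2 := sqErr_nonneg ν x
  have h3 : 0 ≤ avgPow 3 x := Finset.sum_nonneg fun l _ => by positivity
  have h4 := Real.log_natCast_nonneg p
  unfold errBound
  positivity

/-- `errBound` for the moment bound `C` and the optimal smoothing. -/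
def sampleBound (ν : Measure (Obs p)) (C : ℝ≥0) (x : Fin n → Obs p) : ℝ :=
  errBound ν (1 + (C : ℝ) ^ 12) (temperature n p) x

lemma sampleBound_nonneg (x : Fin n → Obs p) : 0 ≤ sampleBound ν C x :=
  errBound_nonneg (by positivity) (temperature_nonneg n p) x

variable [IsProbabilityMeasure ν]

lemma moments_of_hasLaw (hn : n ≠ 0) (hlaw : ∀ l, HasLaw (X l) ν P)
    (hL12 : ∀ l, eLpNorm (fun ω => maxAbs (X l ω)) 12 P ≤ C) :
    Integrable (fun y : Obs p => ‖y‖ ^ 12) ν ∧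
      ∀ k ≤ 12, ∫ y : Obs p, ‖y‖ ^ k ∂ν ≤ 1 + (C : ℝ) ^ 12 := by
  refine integral_norm_pow_le ?_
  have l : Fin n := ⟨0, Nat.pos_of_ne_zero hn⟩
  rw [← (hlaw l).map_eq, eLpNorm_map_measure (by fun_prop) (hlaw l).aemeasurable]
  simpa only [maxAbs_eq_norm, Function.comp_def] using hL12 l

variable [NeZero p]

lemma dF_bootLaw_le_sampleBound (hn : n ≠ 0)
    (hi : Integrable (fun y : Obs p => ‖y‖ ^ 12) ν)
    (hA : ∀ k ≤ 12, ∫ y : Obs p, ‖y‖ ^ k ∂ν ≤ 1 + (C : ℝ) ^ 12)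
    (x : Fin n → Obs p) :
    dF (rootLaw n (bootLaw x)) (rootLaw n (recenteredLaw ν x))
      ≤ ENNReal.ofReal (sampleBound ν C x) := by
  exact dF_bootLaw_le hn (one_le_temperature hn p) (integrable_norm_pow_of_le (by norm_num) hi)
    (by simpa using hA 1 (by norm_num)) (hA 3 (by norm_num)) x

lemma dF_centeredBootLaw_le_sampleBound (hn : n ≠ 0)
    (hi : Integrable (fun y : Obs p => ‖y‖ ^ 12) ν)
    (hA : ∀ k ≤ 12, ∫ y : Obs p, ‖y‖ ^ k ∂ν ≤ 1 + (C : ℝ) ^ 12)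
    (x : Fin n → Obs p) :
    dF (rootLaw n (centeredBootLaw ν x)) (rootLaw n ν)
      ≤ ENNReal.ofReal (sampleBound ν C x) := by
  exact dF_centeredBootLaw_le hn (one_le_temperature hn p)
    (integrable_norm_pow_of_le (by norm_num) hi)
    (by simpa using hA 1 (by norm_num)) (hA 3 (by norm_num)) x

lemma lintegral_sampleBound_le [IsProbabilityMeasure P] (hn : n ≠ 0)
    (hi : Integrable (fun y : Obs p => ‖y‖ ^ 12) ν)
    (hA : ∀ k ≤ 12, ∫ y : Obs p, ‖y‖ ^ k ∂ν ≤ 1 + (C : ℝ) ^ 12)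
    (hlaw : ∀ l, HasLaw (X l) ν P) (hindep : iIndepFun X P) (hp : 1 + Real.log p ≤ n) :
    AEMeasurable (fun ω => ENNReal.ofReal (sampleBound ν C fun l => X l ω)) P ∧
    ∫⁻ ω, ENNReal.ofReal (sampleBound ν C fun l => X l ω) ∂P
      ≤ ENNReal.ofReal (2000 * (1 + (C : ℝ) ^ 12) ^ 4 * rate n p) := by
  obtain ⟨hB, hle⟩ := integral_errBound_le hn (integrable_norm_pow_of_le (by norm_num) hi)
    (fun k hk => hA k (by omega)) (one_le_temperature hn p) (temperature_pow_three n p)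
    (le_temperature_sq hp)
  have hX := hasLaw_sample hlaw hindep
  have hm : AEMeasurable (fun x : Fin n → Obs p => ENNReal.ofReal (sampleBound ν C x))
      (Measure.map (fun ω l => X l ω) P) := by
    rw [hX.map_eq]
    exact hB.1.aemeasurable.ennreal_ofReal
  refine ⟨hm.comp_aemeasurable hX.aemeasurable, ?_⟩
  rw [← lintegral_map' hm hX.aemeasurable, hX.map_eq,
    ← ofReal_integral_eq_lintegral_ofReal (f := sampleBound ν C) hB
      (Eventually.of_forall fun x => sampleBound_nonneg x)]
  exact ENNReal.ofReal_le_ofReal hle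

end Transfer

/-! ### Tail probabilities and data-dependent thresholds. -/

section Smoothing

/-- Outside `[0, 1]` the step is locally constant and its derivatives of positive order vanish; on
`[0, 1]` compactness bounds them. -/
lemma exists_smooth_step : ∃ K : ℝ, 1 ≤ K ∧ ∀ k : ℕ, 1 ≤ k → k ≤ 3 → ∀ x : ℝ,
    |iteratedDeriv k Real.smoothTransition x| ≤ K := by
  have hk (k : ℕ) (hk1 : 1 ≤ k) : ∃ K : ℝ, ∀ x : ℝ,
      |iteratedDeriv k Real.smoothTransition x| ≤ K := by
    have hcont : Continuous (iteratedDeriv k Real.smoothTransition) :=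
      (Real.smoothTransition.contDiff (n := (k : ℕ∞))).continuous_iteratedDeriv k (by simp)
    obtain ⟨K, hK⟩ := (isCompact_Icc (a := (0 : ℝ)) (b := 1)).exists_bound_of_continuousOn
      hcont.continuousOn
    have hK0 : 0 ≤ K := (norm_nonneg _).trans (hK 0 (by simp))
    have hconst {c x : ℝ} (h : Real.smoothTransition =ᶠ[𝓝 x] fun _ => c) :
        |iteratedDeriv k Real.smoothTransition x| ≤ K := by
      rw [h.iteratedDeriv_eq, iteratedDeriv_const, if_neg (by omega), abs_zero]
      exact hK0
    refine ⟨K, fun x => ?_⟩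
    rcases lt_or_ge x 0 with hx | hx
    · exact hconst ((eventually_lt_nhds hx).mono fun y hy =>
        Real.smoothTransition.zero_of_nonpos hy.le)
    rcases lt_or_ge 1 x with hx1 | hx1
    · exact hconst ((eventually_gt_nhds hx1).mono fun y hy =>
        Real.smoothTransition.one_of_one_le hy.le)
    exact hK x ⟨hx, hx1⟩
  obtain ⟨K1, h1⟩ := hk 1 le_rfl
  obtain ⟨K2, h2⟩ := hk 2 (by norm_num)
  obtain ⟨K3, h3⟩ := hk 3 (by norm_num)
  refine ⟨max 1 (max K1 (max K2 K3)), le_max_left _ _, fun k hk1 hk3 x => ?_⟩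
  interval_cases k
  · exact (h1 x).trans (by simp)
  · exact (h2 x).trans (by simp)
  · exact (h3 x).trans (by simp)

/-- The chain rule costs `δ⁻¹ ^ k`, at most `δ⁻¹ ^ 3` as `δ ≤ 1`, and the prefactor compensates for
this. The minus sign fits the order of the two laws in `dF`, since the tail under the second law is
to be bounded by the tail under the first. -/
lemma smooth_step_mem_testClass {K δ t : ℝ} (hK1 : 1 ≤ K)
    (hK : ∀ k : ℕ, 1 ≤ k → k ≤ 3 → ∀ x : ℝ, |iteratedDeriv k Real.smoothTransition x| ≤ K)
    (hδ : 0 < δ) (hδ1 : δ ≤ 1) :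
    (fun x => -(δ ^ 3 / K) * Real.smoothTransition (δ⁻¹ * (x - t))) ∈ testClass := by
  have hs (k : ℕ) : ContDiff ℝ k Real.smoothTransition :=
    Real.smoothTransition.contDiff (n := (k : ℕ∞))
  refine ⟨contDiff_const.mul ((hs 3).comp (contDiff_const.mul
    (contDiff_id.sub contDiff_const))), fun k hk1 hk3 x => ?_⟩
  rw [iteratedDeriv_const_mul_field,
    iteratedDeriv_comp_sub_const k (fun x => Real.smoothTransition (δ⁻¹ * x)) t,
    iteratedDeriv_comp_const_mul (hs k)]
  have hK0 : 0 < K := one_pos.trans_le hK1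
  rw [abs_mul, abs_neg, abs_mul, abs_of_pos (show 0 < δ ^ 3 / K by positivity),
    abs_of_pos (show 0 < δ⁻¹ ^ k by positivity)]
  calc δ ^ 3 / K * (δ⁻¹ ^ k * |iteratedDeriv k Real.smoothTransition (δ⁻¹ * (x - t))|)
      ≤ δ ^ 3 / K * (δ⁻¹ ^ k * K) := by
        gcongr
        exact hK k hk1 hk3 _
    _ = δ ^ 3 * δ⁻¹ ^ k := by field_simp
    _ ≤ δ ^ k * δ⁻¹ ^ k := by
        gcongr ?_ * _
        exact pow_le_pow_of_le_one hδ.le hδ1 hk3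
    _ = 1 := by rw [← mul_pow, mul_inv_cancel₀ hδ.ne', one_pow]

/-- Smoothing: the metric `dF` controls tail probabilities up to a shift. -/
lemma measureReal_Ici_le_of_dF_le {K : ℝ} (hK1 : 1 ≤ K)
    (hK : ∀ k : ℕ, 1 ≤ k → k ≤ 3 → ∀ x : ℝ, |iteratedDeriv k Real.smoothTransition x| ≤ K)
    {ζ ρ : Measure ℝ} [IsProbabilityMeasure ζ] [IsProbabilityMeasure ρ] {e δ : ℝ} (he : 0 ≤ e)
    (hd : dF ζ ρ ≤ ENNReal.ofReal e) (hδ : 0 < δ) (hδ1 : δ ≤ 1) (t : ℝ) :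
    ρ.real (Set.Ici (t + δ)) ≤ ζ.real (Set.Ici t) + K * e / δ ^ 3 := by
  have hK0 : 0 < K := one_pos.trans_le hK1
  set ψ : ℝ → ℝ := fun x => Real.smoothTransition (δ⁻¹ * (x - t)) with hψ
  have hcont : Continuous ψ := Real.smoothTransition.continuous.comp (by fun_prop)
  have hint {μ : Measure ℝ} [IsProbabilityMeasure μ] : Integrable ψ μ :=
    (integrable_const (1 : ℝ)).mono' hcont.aestronglyMeasurable (Eventually.of_forall fun x => by
      rw [Real.norm_of_nonneg (Real.smoothTransition.nonneg _)]
      exact Real.smoothTransition.le_one _)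
  have hind {μ : Measure ℝ} [IsProbabilityMeasure μ] (s : ℝ) :
      Integrable ((Set.Ici s).indicator (1 : ℝ → ℝ)) μ :=
    (integrable_const (1 : ℝ)).indicator measurableSet_Ici
  have h1 : ρ.real (Set.Ici (t + δ)) ≤ ∫ x, ψ x ∂ρ := by
    rw [← integral_indicator_one measurableSet_Ici]
    refine integral_mono (hind _) hint fun x => ?_
    by_cases hx : x ∈ Set.Ici (t + δ)
    · rw [Set.indicator_of_mem hx]
      refine (Real.smoothTransition.one_of_one_le ?_).ge
      rw [← div_eq_inv_mul, le_div_iff₀ hδ]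
      linarith [Set.mem_Ici.1 hx]
    · rw [Set.indicator_of_notMem hx]
      exact Real.smoothTransition.nonneg _
  have h2 : ∫ x, ψ x ∂ζ ≤ ζ.real (Set.Ici t) := by
    rw [← integral_indicator_one measurableSet_Ici]
    refine integral_mono hint (hind _) fun x => ?_
    by_cases hx : x ∈ Set.Ici t
    · rw [Set.indicator_of_mem hx]
      exact Real.smoothTransition.le_one _
    · rw [Set.indicator_of_notMem hx]
      refine (Real.smoothTransition.zero_of_nonpos ?_).le
      exact mul_nonpos_of_nonneg_of_nonpos (inv_nonneg.2 hδ.le)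
        (by linarith [not_le.1 (Set.mem_Ici.not.1 hx)])
  have h3 := (le_iSup₂ (f := fun h (_ : h ∈ testClass) =>
    ENNReal.ofReal ((∫ s, h s ∂ζ) - ∫ s, h s ∂ρ)) _
    (smooth_step_mem_testClass (t := t) hK1 hK hδ hδ1)).trans hd
  rw [ENNReal.ofReal_le_ofReal_iff he, integral_const_mul, integral_const_mul] at h3
  have h4 : δ ^ 3 / K * (∫ x, ψ x ∂ρ - ∫ x, ψ x ∂ζ) ≤ e := by
    refine (le_of_eq ?_).trans h3
    ring
  have h5 : ∫ x, ψ x ∂ρ - ∫ x, ψ x ∂ζ ≤ K * e / δ ^ 3 := by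
    rw [le_div_iff₀ (by positivity)]
    calc (∫ x, ψ x ∂ρ - ∫ x, ψ x ∂ζ) * δ ^ 3
        = K * (δ ^ 3 / K * (∫ x, ψ x ∂ρ - ∫ x, ψ x ∂ζ)) := by field_simp
      _ ≤ K * e := by gcongr
  linarith

/-- A data-dependent threshold whose tail probability under the law of `R` is small yields a
valid test after a shift, although the threshold may depend on `R`. -/
lemma measure_shifted_threshold_le {Ω : Type*} [MeasurableSpace Ω] {P : Measure Ω}
    {R : Ω → ℝ} {ρ : Measure ℝ} [IsProbabilityMeasure ρ] (hR : HasLaw R ρ P) {τ : Ω → ℝ}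
    {G : Set Ω} {a : ℝ≥0∞} {δ : ℝ} (hδ : 0 < δ)
    (hG : ∀ᵐ ω ∂P, ω ∈ G → ρ (Set.Ici (τ ω + δ)) ≤ a) :
    P {ω | τ ω + 2 * δ ≤ R ω} ≤ a + P Gᶜ := by
  -- This set of levels is deterministic and upward closed. On `G` it contains `τ ω + δ`, so `τ ω +
  -- 2 * δ ≤ R ω` forces `R ω` into the fixed set `U`.
  set S : Set ℝ := {s | ρ (Set.Ici s) ≤ a} with hS
  obtain ⟨U, hUm, hUa, hU⟩ : ∃ U : Set ℝ, MeasurableSet U ∧ ρ U ≤ a ∧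
      ∀ s ∈ S, ∀ u, s + δ ≤ u → u ∈ U := by
    rcases S.eq_empty_or_nonempty with h | hne
    · exact ⟨∅, MeasurableSet.empty, by simp, by simp [h]⟩
    by_cases hb : BddBelow S
    -- The infimum need not belong to `S`; the second `δ` guarantees a member of `S` below `sInf S +
    -- δ`.
    · refine ⟨Set.Ici (sInf S + δ), measurableSet_Ici, ?_, fun s hs u hu => ?_⟩
      · obtain ⟨s, hs, hlt⟩ := exists_lt_of_csInf_lt hne (lt_add_of_pos_right (sInf S) hδ)
        exact (measure_mono (Set.Ici_subset_Ici.2 hlt.le)).trans hs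
      · exact (add_le_add_left (csInf_le hb hs) δ).trans hu
    · refine ⟨Set.univ, MeasurableSet.univ, ?_, fun _ _ _ _ => trivial⟩
      refine le_of_tendsto (tendsto_measure_Ici_atBot ρ) ?_
      filter_upwards with x
      obtain ⟨s, hs, hlt⟩ := not_bddBelow_iff.1 hb x
      exact (measure_mono (Set.Ici_subset_Ici.2 hlt.le)).trans hs
  calc P {ω | τ ω + 2 * δ ≤ R ω} ≤ P (R ⁻¹' U ∪ Gᶜ) := by
        refine measure_mono_ae ?_
        filter_upwards [hG] with ω hω hle
        by_cases h : ω ∈ G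
        · refine Or.inl (hU _ (hω h) _ ?_)
          have : τ ω + 2 * δ ≤ R ω := hle
          linarith
        · exact Or.inr h
    _ ≤ P (R ⁻¹' U) + P Gᶜ := measure_union_le _ _
    _ = ρ U + P Gᶜ := by rw [← hR.map_eq, Measure.map_apply_of_aemeasurable hR.aemeasurable hUm]
    _ ≤ _ := by gcongr

end Smoothing

/-! ### Rejection probability of the bootstrap test. -/

section Rejection

variable {n p : ℕ} {Ω : Type*} [MeasurableSpace Ω] {P : Measure Ω}
  [IsProbabilityMeasure P] {ν : Measure (Obs p)}
  {X : Fin n → Ω → Obs p} {C : ℝ≥0}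

lemma isProbabilityMeasure_rootLaw (m : Measure (Obs p)) [IsProbabilityMeasure m] :
    IsProbabilityMeasure (rootLaw n m) :=
  Measure.isProbabilityMeasure_map (measurable_root _).aemeasurable

lemma hasLaw_root (hlaw : ∀ l, HasLaw (X l) ν P) (hindep : iIndepFun X P) :
    HasLaw (fun ω => √(n : ℝ) * (thetaHat (fun l => X l ω) - theta ν)) (rootLaw n ν) P := by
  have hX := hasLaw_sample hlaw hindep
  refine ⟨(measurable_root (theta ν)).comp_aemeasurable hX.aemeasurable, ?_⟩
  rw [rootLaw, ← hX.map_eq, AEMeasurable.map_map_of_aemeasurable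
    (measurable_root _).aemeasurable hX.aemeasurable]
  rfl

variable [NeZero p] [IsProbabilityMeasure ν]

/-- A non-asymptotic bound for the rejection probability of the bootstrap test. -/
theorem measure_reject_le {K : ℝ} (hK1 : 1 ≤ K)
    (hK : ∀ k : ℕ, 1 ≤ k → k ≤ 3 → ∀ x : ℝ, |iteratedDeriv k Real.smoothTransition x| ≤ K)
    (hn : n ≠ 0) (hp : 1 + Real.log p ≤ n) (hlaw : ∀ l, HasLaw (X l) ν P)
    (hindep : iIndepFun X P) (hL12 : ∀ l, eLpNorm (fun ω => maxAbs (X l ω)) 12 P ≤ C)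
    {α η ε : ℝ} (hα : 0 ≤ α) (hη : 0 < η) (hε : 0 < ε) (hε2 : ε ≤ 2) {t : (Fin n → Obs p) → ℝ}
    (ht : ∀ᵐ ω ∂P, rootLaw n (centeredBootLaw ν fun l => X l ω) (Set.Ici (t fun l => X l ω))
      ≤ ENNReal.ofReal α) :
    P {ω | t (fun l => X l ω) + ε ≤ √(n : ℝ) * (thetaHat (fun l => X l ω) - theta ν)}
      ≤ ENNReal.ofReal (α + η) + ENNReal.ofReal (2000 * (1 + (C : ℝ) ^ 12) ^ 4 * (8 * K / η)
        * (rate n p / ε ^ 3)) := by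
  obtain ⟨hi, hA⟩ := moments_of_hasLaw hn hlaw hL12
  have hK0 : 0 < K := one_pos.trans_le hK1
  have hδ : 0 < ε / 2 := half_pos hε
  -- The accuracy at which the smoothing loss `K * e / (ε / 2) ^ 3` equals `η`. Half of `ε` pays for
  -- smoothing, the other half for the random threshold.
  set e := η * (ε / 2) ^ 3 / K with he
  have he0 : 0 < e := by positivity
  have hρ := isProbabilityMeasure_rootLaw (n := n) ν
  obtain ⟨hBm, hB⟩ := lintegral_sampleBound_le hn hi hA hlaw hindep hp
  set G : Set Ω := {ω | sampleBound ν C (fun l => X l ω) < e} with hG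
  have hGle : ∀ᵐ ω ∂P, ω ∈ G →
      rootLaw n ν (Set.Ici (t (fun l => X l ω) + ε / 2)) ≤ ENNReal.ofReal (α + η) := by
    filter_upwards [ht] with ω hω hωG
    have := isProbabilityMeasure_centeredBootLaw hn ν fun l => X l ω
    have hζ := isProbabilityMeasure_rootLaw (n := n) (centeredBootLaw ν fun l => X l ω)
    have h1 := measureReal_Ici_le_of_dF_le hK1 hK he0.le
      ((dF_centeredBootLaw_le_sampleBound hn hi hA fun l => X l ω).trans
        (ENNReal.ofReal_le_ofReal (le_of_lt hωG))) hδ (by linarith) (t fun l => X l ω)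
    have h2 : (rootLaw n (centeredBootLaw ν fun l => X l ω)).real
        (Set.Ici (t fun l => X l ω)) ≤ α := ENNReal.toReal_le_of_le_ofReal hα hω
    have h3 : K * e / (ε / 2) ^ 3 = η := by
      rw [he]
      field_simp
    rw [← ofReal_measureReal]
    exact ENNReal.ofReal_le_ofReal (by linarith)
  have hGc : P Gᶜ ≤ ENNReal.ofReal (2000 * (1 + (C : ℝ) ^ 12) ^ 4 * (8 * K / η)
        * (rate n p / ε ^ 3)) := by
    calc P Gᶜ ≤ P {ω | ENNReal.ofReal e ≤ ENNReal.ofReal (sampleBound ν C fun l => X l ω)} := by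
          refine measure_mono fun ω hω => ENNReal.ofReal_le_ofReal ?_
          exact not_lt.1 hω
      _ ≤ (∫⁻ ω, ENNReal.ofReal (sampleBound ν C fun l => X l ω) ∂P) / ENNReal.ofReal e :=
          meas_ge_le_lintegral_div hBm (by simpa using he0) ENNReal.ofReal_ne_top
      _ ≤ ENNReal.ofReal (2000 * (1 + (C : ℝ) ^ 12) ^ 4 * rate n p) / ENNReal.ofReal e := by
          gcongr
      _ = _ := by
          rw [← ENNReal.ofReal_div_of_pos he0]
          congr 1
          rw [he]
          field_simp
          ring
  have h := measure_shifted_threshold_le (hasLaw_root hlaw hindep) hδ hGle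
  rw [mul_div_cancel₀ ε two_ne_zero] at h
  exact h.trans (by gcongr)

end Rejection

end

end MinMaxBootstrap

theorem mainTheorem10
    (p : ℕ → ℕ) (hp : ∀ n, 1 ≤ p n)
    (hlog : (fun n : ℕ => Real.log (p n)) =o[atTop] (fun n : ℕ => (n : ℝ) ^ (1 / 4 : ℝ)))
    {Ω : ℕ → Type*} [∀ n, MeasurableSpace (Ω n)]
    (P : ∀ n, Measure (Ω n)) [∀ n, IsProbabilityMeasure (P n)]
    (ν : ∀ n, Measure (MinMaxBootstrap.Obs (p n))) [∀ n, IsProbabilityMeasure (ν n)]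
    (X : ∀ n, Fin n → Ω n → MinMaxBootstrap.Obs (p n))
    (hlaw : ∀ n l, HasLaw (X n l) (ν n) (P n))
    (hindep : ∀ n, iIndepFun (X n) (P n))
    (C : ℝ≥0)
    (hL12 : ∀ n l, eLpNorm (fun ω => MinMaxBootstrap.maxAbs (X n l ω)) 12 (P n) ≤ C) :
    Tendsto (fun n => ∫⁻ ω, MinMaxBootstrap.dF
        (MinMaxBootstrap.rootLaw n (MinMaxBootstrap.bootLaw (fun l => X n l ω)))
        (MinMaxBootstrap.rootLaw n (MinMaxBootstrap.recenteredLaw (ν n) (fun l => X n l ω)))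
        ∂(P n)) atTop (𝓝 0)
    ∧ Tendsto (fun n => ∫⁻ ω, MinMaxBootstrap.dF
        (MinMaxBootstrap.rootLaw n (MinMaxBootstrap.centeredBootLaw (ν n) (fun l => X n l ω)))
        (MinMaxBootstrap.rootLaw n (ν n))
        ∂(P n)) atTop (𝓝 0)
    ∧ ((∀ᶠ n in atTop, 2 ≤ p n) →
        ∀ (α : ℝ), 0 ≤ α → α ≤ 1 →
        ∀ (t : ∀ n, (Fin n → MinMaxBootstrap.Obs (p n)) → ℝ),
        (∀ n, ∀ᵐ ω ∂(P n),
          MinMaxBootstrap.rootLaw n (MinMaxBootstrap.centeredBootLaw (ν n) (fun l => X n l ω))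
            (Set.Ici (t n (fun l => X n l ω))) ≤ ENNReal.ofReal α) →
        ∀ (ε : ℕ → ℝ), (∀ n, 0 < ε n) → Tendsto ε atTop (𝓝 0) →
        (fun n : ℕ => (Real.log (p n) ^ 2 / √(n : ℝ)) ^ (1 / 9 : ℝ)) =o[atTop] ε →
        limsup (fun n => P n {ω | t n (fun l => X n l ω) + ε n
            ≤ √(n : ℝ) * (MinMaxBootstrap.thetaHat (fun l => X n l ω)
                - MinMaxBootstrap.theta (ν n))}) atTop
          ≤ ENNReal.ofReal α) := by
  have hpz (n : ℕ) : NeZero (p n) := ⟨Nat.one_le_iff_ne_zero.1 (hp n)⟩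
  have hrate := MinMaxBootstrap.tendsto_rate hlog
  have hpn := MinMaxBootstrap.eventually_one_add_log_le hlog
  have hlim : Tendsto (fun n => ENNReal.ofReal
      (2000 * (1 + (C : ℝ) ^ 12) ^ 4 * MinMaxBootstrap.rate n (p n))) atTop (𝓝 0) := by
    simpa using ENNReal.tendsto_ofReal (hrate.const_mul (2000 * (1 + (C : ℝ) ^ 12) ^ 4))
  refine ⟨?_, ?_, ?_⟩
  · refine tendsto_of_tendsto_of_tendsto_of_le_of_le' tendsto_const_nhds hlim
      (Eventually.of_forall fun n => zero_le) ?_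
    filter_upwards [hpn, eventually_ne_atTop 0] with n hn1 hn
    obtain ⟨hi, hA⟩ := MinMaxBootstrap.moments_of_hasLaw hn (hlaw n) (hL12 n)
    -- `dF` is a supremum over an uncountable class, but its measurability in `ω` is not needed:
    -- monotonicity of the lower integral holds for all functions.
    exact (lintegral_mono fun ω => MinMaxBootstrap.dF_bootLaw_le_sampleBound hn hi hA _).trans
      (MinMaxBootstrap.lintegral_sampleBound_le hn hi hA (hlaw n) (hindep n) hn1).2
  · refine tendsto_of_tendsto_of_tendsto_of_le_of_le' tendsto_const_nhds hlim
      (Eventually.of_forall fun n => zero_le) ?_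
    filter_upwards [hpn, eventually_ne_atTop 0] with n hn1 hn
    obtain ⟨hi, hA⟩ := MinMaxBootstrap.moments_of_hasLaw hn (hlaw n) (hL12 n)
    exact (lintegral_mono fun ω =>
      MinMaxBootstrap.dF_centeredBootLaw_le_sampleBound hn hi hA _).trans
      (MinMaxBootstrap.lintegral_sampleBound_le hn hi hA (hlaw n) (hindep n) hn1).2
  · intro hp2 α hα _ t ht ε hε hε0 ho
    obtain ⟨K, hK1, hK⟩ := MinMaxBootstrap.exists_smooth_step
    have hdiv := MinMaxBootstrap.tendsto_rate_div_pow_three hp2 hε ho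
    refine ENNReal.le_of_forall_pos_le_add fun e he _ => ?_
    -- One half of the slack is spent on the level `α + η`, the other on the probability of the bad
    -- event.
    have hη : (0 : ℝ) < e / 2 := by
      have : (0 : ℝ) < e := he
      positivity
    have hsmall := (hdiv.const_mul (2000 * (1 + (C : ℝ) ^ 12) ^ 4 * (8 * K / (e / 2))))
    rw [mul_zero] at hsmall
    refine limsup_le_of_le (by isBoundedDefault) ?_
    filter_upwards [hpn, eventually_ne_atTop 0, hsmall.eventually (eventually_le_nhds hη),
      hε0.eventually (eventually_le_nhds two_pos)] with n hn1 hn hs hε2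
    refine (MinMaxBootstrap.measure_reject_le hK1 hK hn hn1 (hlaw n) (hindep n) (hL12 n) hα hη
      (hε n) hε2 (ht n)).trans ?_
    refine (add_le_add_right (ENNReal.ofReal_le_ofReal hs) _).trans_eq ?_
    rw [ENNReal.ofReal_add hα hη.le, add_assoc, ← ENNReal.ofReal_add hη.le hη.le, add_halves,
      ENNReal.ofReal_coe_nnreal]
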